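/- Let $A$ be a unital $C^*$-algebra, let $\mathfrak A=*_{i=1}^\infty A$ be the universal unital free product of countably many copies of $A$, with canonical embeddings $\lambda_i:A\to\mathfrak A$, and let $\psi$ be a symmetric state on $\mathfrak A$, i.e. a state with $$\psi(\lambda_{i_1}(a_1)\cdots\lambda_{i_n}(a_n))=\psi(\lambda_{\sigma(i_1)}(a_1)\cdots\lambda_{\sigma(i_n)}(a_n))$$ for all $n\in\mathbb N$, $i_1,\dots,i_n\in\mathbb N$, $a_1,\dots,a_n\in A$ and all permutations $\sigma$ of $\mathbb N$. Let $SS(A)$ be the convex set of symmetric states on $\mathfrak A$. Let $\pi_\psi:\mathfrak A\to B(L^2(\mathfrak A,\psi))$ be the GNS representation, $\hat 1\in L^2(\mathfrak A,\psi)$ the class of the unit, $\hat\psi=\langle\,\cdot\,\hat 1,\hat 1\rangle$ the associated vector state, and $\pi_i=\pi_\psi\circ\lambda_i$. Let $\mathcal T_\psi=\bigcap_{N\ge1}W^*\big(\bigcup_{i\ge N}\pi_i(A)\big)$ be the tail algebra, and let $\mathcal Q_\psi$ be the $C^*$-algebra generated by $\pi_\psi(\mathfrak A)\cup\mathcal T_\psi$.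 There is a unique $*$-endomorphism $\alpha$ of $\mathcal Q_\psi$ with $\alpha\circ\pi_i=\pi_{i+1}$ for all $i$ and $\alpha|_{\mathcal T_\psi}=\mathrm{id}$, and for every $x\in\mathcal Q_\psi$ the limit in the weak operator topology $F_\psi(x)=\lim_{n\to\infty}\alpha^n(x)$ exists and lies in $\mathcal T_\psi$. Let $D_\psi$ be the tail $C^*$-algebra of $\psi$, the smallest unital $C^*$-subalgebra of $\mathcal T_\psi$ such that $$F_\psi\big(\pi_{i_1}(a_1)x_1\pi_{i_2}(a_2)x_2\cdots x_{n-1}\pi_{i_n}(a_n)\big)\in D_\psi$$ for all $n\ge1$, $i_1,\dots,i_n\in\mathbb N$, $a_1,\dots,a_n\in A$ and $x_1,\dots,x_{n-1}\in D_\psi$. Let $\rho=\hat\psi|_{D_\psi}$. Then $F_\psi(\pi_\psi(\mathfrak A))\subseteq D_\psi$ and $$\psi=\rho\circ F_\psi\circ\pi_\psi .$$ Moreover: (i) if $\rho$ is a pure state of $D_\psi$, then $\psi$ is an extreme point of $SS(A)$; (ii) if $\psi$ is an extreme point of $SS(A)$ and $D_\psi\subseteq\pi_\psi(\mathfrak A)$,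 then $\rho$ is a pure state of $D_\psi$. -/

import Mathlib

open scoped ComplexOrder InnerProductSpace ENNReal Topology

universe u

noncomputable section

/-! ### States -/

/-- The set of states of a unital `*`-algebra over `ℂ` (here always a unital C⋆-algebra): the
positive linear functionals that take the value `1` at the unit. -/
def stateSpace (B : Type*) [Ring B] [StarRing B] [Algebra ℂ B] : Set (B →ₗ[ℂ] ℂ) :=
  {φ | φ 1 = 1 ∧ ∀ b : B, 0 ≤ φ (star b * b)}

/-- A pure state is an extreme point of the state space. -/
def IsPureState {B : Type*} [Ring B] [StarRing B] [Algebra ℂ B] (φ : B →ₗ[ℂ] ℂ) : Prop :=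
  φ ∈ Set.extremePoints ℝ (stateSpace B)

/-! ### The universal unital free product of countably many copies of a unital C⋆-algebra -/

/-- A (nonzero) unital C⋆-algebra together with a sequence of unital `*`-homomorphisms from `A`
into it. -/
structure FreeProdRep (A : Type u) [CStarAlgebra A] where
  carrier : Type u
  [cstar : CStarAlgebra carrier]
  [nontriv : Nontrivial carrier]
  hom : ℕ → A →⋆ₐ[ℂ] carrier

attribute [instance] FreeProdRep.cstar FreeProdRep.nontriv

variable (A : Type u) [CStarAlgebra A]

/-- The C⋆-algebra of bounded families indexed by all sequences of unital `*`-homomorphisms from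
`A` into unital C⋆-algebras. -/
abbrev FreeProdAmbient : Type (u + 1) := lp (fun r : FreeProdRep A => r.carrier) ∞

instance : CStarAlgebra (FreeProdAmbient A) where

variable {A} in
lemma memℓp_hom (i : ℕ) (a : A) :
    Memℓp (fun r : FreeProdRep A => r.hom i a) ∞ :=
  memℓp_infty ⟨‖a‖, by
    rintro _ ⟨r, rfl⟩
    exact NonUnitalStarAlgHom.norm_apply_le (r.hom i) a⟩

/-- The `i`-th copy of `A` in the ambient algebra: `a ↦ (π i a)_π`. -/
def ambientIncl (i : ℕ) : A →⋆ₐ[ℂ] FreeProdAmbient A where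
  toFun a := ⟨fun r => r.hom i a, memℓp_hom i a⟩
  map_one' := by ext r; simp
  map_mul' a b := by ext r; simp
  map_zero' := by ext r; simp
  map_add' a b := by ext r; exact map_add (r.hom i) a b
  commutes' c := by ext r; simp [Algebra.algebraMap_eq_smul_one]
  map_star' a := by ext r; simp [map_star]

/-- The closed star subalgebra of the ambient algebra generated by the copies of `A`. -/
def freeProdSubalgebra : StarSubalgebra ℂ (FreeProdAmbient A) :=
  (StarAlgebra.adjoin ℂ (⋃ i, Set.range (ambientIncl A i))).topologicalClosure

instance : IsClosed (freeProdSubalgebra A : Set (FreeProdAmbient A)) :=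
  StarSubalgebra.isClosed_topologicalClosure _

/-- The universal unital free product C⋆-algebra of the copies `A_i = A`, `i ∈ ℕ`. Its norm on
words in the copies of `A` is the supremum of the norms over all representations; see
`FreeProd.existsUnique_lift` for the universal property. (A C⋆-algebra generated by countably many
images of a nonzero `A` has at most the cardinality of `A`, so that representations in the universe
of `A` suffice.) -/
def FreeProd : Type (u + 1) := freeProdSubalgebra A

namespace FreeProd

instance : CStarAlgebra (FreeProd A) :=
  inferInstanceAs (CStarAlgebra (freeProdSubalgebra A))

/-- The usual order of a C⋆-algebra. -/
instance : PartialOrder (FreeProd A) := CStarAlgebra.spectralOrder _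

instance : StarOrderedRing (FreeProd A) := CStarAlgebra.spectralOrderedRing _

/-- The canonical embedding of `A` as the `i`-th free factor. -/
def incl (i : ℕ) : A →⋆ₐ[ℂ] FreeProd A :=
  (ambientIncl A i).codRestrict (freeProdSubalgebra A) fun a =>
    StarSubalgebra.le_topologicalClosure _
      (StarAlgebra.subset_adjoin ℂ _ (Set.mem_iUnion.2 ⟨i, a, rfl⟩))

/-- Universal property of the free product. -/
theorem existsUnique_lift {B : Type u} [CStarAlgebra B] (π : ℕ → A →⋆ₐ[ℂ] B) :
    ∃! Φ : FreeProd A →⋆ₐ[ℂ] B, ∀ i a, Φ (incl A i a) = π i a := by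
  rcases subsingleton_or_nontrivial B with hB | hB
  · refine ⟨⟨⟨⟨⟨⟨fun _ => 0, Subsingleton.elim _ _⟩, fun _ _ => Subsingleton.elim _ _⟩,
      Subsingleton.elim _ _, fun _ _ => Subsingleton.elim _ _⟩, fun _ => Subsingleton.elim _ _⟩,
      fun _ => Subsingleton.elim _ _⟩, fun _ _ => Subsingleton.elim _ _, fun Ψ _ => ?_⟩
    ext x
    exact Subsingleton.elim _ _
  · let r : FreeProdRep A := { carrier := B, hom := π }
    let ev : FreeProdAmbient A →⋆ₐ[ℂ] B :=
      { toFun := fun f => f r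
        map_one' := rfl
        map_mul' := fun _ _ => rfl
        map_zero' := rfl
        map_add' := fun _ _ => rfl
        commutes' := fun _ => rfl
        map_star' := fun _ => rfl }
    refine ⟨ev.comp (freeProdSubalgebra A).subtype, fun i a => rfl, fun Ψ hΨ => ?_⟩
    have h₁ : Continuous (Ψ : FreeProd A → B) :=
      AddMonoidHomClass.continuous_of_bound Ψ 1 fun x => by
        simpa using NonUnitalStarAlgHom.norm_apply_le Ψ x
    have h₂ : Continuous fun x : freeProdSubalgebra A => ev x :=
      (AddMonoidHomClass.continuous_of_bound ev 1 fun x => by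
        simpa using NonUnitalStarAlgHom.norm_apply_le ev x).comp continuous_subtype_val
    refine StarAlgHom.ext_topologicalClosure (S := StarAlgebra.adjoin ℂ _)
      (φ := Ψ) (ψ := ev.comp (freeProdSubalgebra A).subtype) h₁ h₂ ?_
    · apply StarAlgHom.ext_adjoin
      rintro ⟨_, hx'⟩ hx
      obtain ⟨i, a, rfl⟩ := Set.mem_iUnion.1 hx
      exact hΨ i a

end FreeProd

/-! ### Symmetric states -/

/-- The set of symmetric states on the free product: the states that do not change if the indices
of the free factors in a word are permuted. -/
def symmetricStates : Set (FreeProd A →ₗ[ℂ] ℂ) :=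
  {φ | φ ∈ stateSpace (FreeProd A) ∧ ∀ (σ : Equiv.Perm ℕ) (w : List (ℕ × A)),
    φ (w.map fun p => FreeProd.incl A p.1 p.2).prod =
      φ (w.map fun p => FreeProd.incl A (σ p.1) p.2).prod}

/-! ### The tail algebra and its conditional expectation

The constructions are written for a positive linear functional `ψ` on the free product; they are
used for symmetric states. -/

/-- The von Neumann algebra (double commutant) generated by a set of operators. -/
def generatedVN {H : Type*} [NormedAddCommGroup H] [InnerProductSpace ℂ H] [CompleteSpace H]
    (S : Set (H →L[ℂ] H)) : StarSubalgebra ℂ (H →L[ℂ] H) :=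
  StarSubalgebra.centralizer ℂ (StarSubalgebra.centralizer ℂ S : Set (H →L[ℂ] H))

variable {A}
variable (ψ : FreeProd A →ₚ[ℂ] ℂ)

/-- The bounded operators on the GNS space `L²(𝔄, ψ)`. -/
abbrev GNSOp : Type (u + 1) := ψ.GNS →L[ℂ] ψ.GNS

/-- The class of `1` in the GNS space. -/
def gnsVacuum : ψ.GNS := ((ψ.toPreGNS 1 : ψ.PreGNS) : ψ.GNS)

/-- The vector functional `T ↦ ⟨T 1̂, 1̂⟩` (Mathlib's inner product is linear on the right). -/
def vacuumState : GNSOp ψ →ₗ[ℂ] ℂ where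
  toFun T := ⟪gnsVacuum ψ, T (gnsVacuum ψ)⟫_ℂ
  map_add' S T := by simp [inner_add_right]
  map_smul' c T := by simp [inner_smul_right]

/-- The representation of the `i`-th free factor on the GNS space. -/
def gnsFactor (i : ℕ) : A →⋆ₐ[ℂ] GNSOp ψ :=
  ψ.gnsStarAlgHom.comp (FreeProd.incl A i)

/-- The tail algebra `⋂_N W*(⋃_{i ≥ N} π_ψ(λ_i(A)))`. -/
def tailAlgebra : StarSubalgebra ℂ (GNSOp ψ) :=
  ⨅ N : ℕ, generatedVN (⋃ i ≥ N, Set.range (gnsFactor ψ i))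

/-- The C⋆-algebra generated by `π_ψ(𝔄)` and the tail algebra. -/
def tailExtension : StarSubalgebra ℂ (GNSOp ψ) :=
  (StarAlgebra.adjoin ℂ
    (Set.range ψ.gnsStarAlgHom ∪ (tailAlgebra ψ : Set (GNSOp ψ)))).topologicalClosure

/-- `α` is the shift of `tailExtension ψ`: it sends the `i`-th copy of `A` to the `(i+1)`-st one
and fixes the tail algebra. -/
def IsTailShift (α : tailExtension ψ →⋆ₐ[ℂ] tailExtension ψ) : Prop :=
  (∀ (i : ℕ) (a : A) (x : tailExtension ψ),
    (x : GNSOp ψ) = gnsFactor ψ i a → (α x : GNSOp ψ) = gnsFactor ψ (i + 1) a) ∧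
  ∀ x : tailExtension ψ, (x : GNSOp ψ) ∈ tailAlgebra ψ → α x = x

/-- The shift endomorphism: the `*`-endomorphism singled out by `IsTailShift`. -/
def tailShift : tailExtension ψ →⋆ₐ[ℂ] tailExtension ψ :=
  Classical.epsilon (IsTailShift ψ)

/-- The sequence `αⁿ(x)`, as operators with the weak operator topology. -/
def shiftOrbit (x : tailExtension ψ) (n : ℕ) : ψ.GNS →WOT[ℂ] ψ.GNS :=
  .ofCLM ((tailShift ψ)^[n] x : GNSOp ψ)

/-- The conditional expectation onto the tail algebra, `F_ψ(x) = WOT-lim αⁿ(x)`. -/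
def tailExpectation (x : tailExtension ψ) : GNSOp ψ :=
  (Filter.limUnder Filter.atTop (shiftOrbit ψ x)).toCLM

/-! ### The tail C⋆-algebra -/

/-- `S` contains `F_ψ(π_{i₁}(a₁) x₁ π_{i₂}(a₂) x₂ ⋯ x_{n-1} π_{iₙ}(aₙ))` for all `n ≥ 1`, all
`a₁, …, aₙ ∈ A` and all `x₁, …, x_{n-1} ∈ S`. (All these words lie in `tailExtension ψ` if `S` is
contained in the tail algebra.) -/
def IsTailInvariant (S : StarSubalgebra ℂ (GNSOp ψ)) : Prop :=
  ∀ (i : ℕ) (a : A) (w : List (S × ℕ × A)) (z : tailExtension ψ),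
    (z : GNSOp ψ) =
      gnsFactor ψ i a * (w.map fun t => (t.1 : GNSOp ψ) * gnsFactor ψ t.2.1 t.2.2).prod →
    tailExpectation ψ z ∈ S

/-- The tail C⋆-algebra: the smallest unital C⋆-subalgebra of the tail algebra with the above
invariance. -/
def tailCStar : StarSubalgebra ℂ (GNSOp ψ) :=
  sInf {S | S ≤ tailAlgebra ψ ∧ IsClosed (S : Set (GNSOp ψ)) ∧ IsTailInvariant ψ S}

/-- The restriction of the vector state to the tail C⋆-algebra. -/
def tailRestriction : tailCStar ψ →ₗ[ℂ] ℂ :=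
  (vacuumState ψ).comp (tailCStar ψ).subtype.toAlgHom.toLinearMap

/-- `π_ψ` with values in `tailExtension ψ`. -/
def gnsToExtension : FreeProd A →⋆ₐ[ℂ] tailExtension ψ :=
  ψ.gnsStarAlgHom.codRestrict (tailExtension ψ) fun x =>
    StarSubalgebra.le_topologicalClosure _
      (StarAlgebra.subset_adjoin ℂ _ (Or.inl ⟨x, rfl⟩))

end

/-! Symmetry of `ψ` makes every permutation σ of the factors act on the GNS space by a unitary U_σ
that fixes the vacuum (`gnsPerm`). If σ fixes all i ≥ K, then U_σ commutes with the factors of index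
at least K, hence with the tail algebra (`commute_gnsPerm_of_mem_tailAlgebra`). So conjugation by a
finitary σ permutes the factors and fixes the tail. On the algebra generated by the tail and the
first M factors, the n-th power of the shift is therefore conjugation by any finitary σ with σ(i) =
i + n for i < M (`iterate_eq_gnsConj`).

This gives the shift as a pointwise norm limit of conjugations. It also makes the matrix
coefficients of αⁿ(x), between vectors from the first K factors, independent of n ≥ K
(`inner_iterate_eq`): two choices of n differ by a permutation fixing 0, …, K - 1. By density the
weak limit F exists. It lies in the tail because αⁿ(x) belongs to the von Neumann algebra of the
factors of index at least N once n ≥ N. The vacuum coefficient of αⁿ(π(x)) is constantly ψ(x), so ψ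
= ρ ∘ F ∘ π.

For (i), let ψ = aφ₁ + bφ₂. Since φ₁ ≤ a⁻¹ψ, the canonical map J from L²(ψ) to L²(φ₁) is bounded,
and J*J commutes with π(𝔄), hence with the tail. Thus ρ₁(d) = ⟨J*J d 1̂, 1̂⟩ is a state on D with φ₁
= ρ₁ ∘ F ∘ π, and likewise for φ₂. Then ρ = aρ₁ + bρ₂, and purity forces ρ₁ = ρ, so φ₁ = ψ.

For (ii), F is positive and blind to permutations, so each state ρ' of D yields a symmetric state ρ'
∘ F ∘ π. A decomposition of ρ thus decomposes ψ, and extremality gives ρ₁ ∘ F ∘ π = ρ ∘ F ∘ π. As F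
fixes the tail, D ⊆ π(𝔄) makes every d ∈ D of the form F(π(x)), so ρ₁ = ρ. -/

/-! ### Finitely supported permutations of `ℕ` -/

/-- The permutation fixes all but finitely many natural numbers. -/
def Equiv.Perm.IsFinitary (σ : Equiv.Perm ℕ) : Prop := ∃ K, ∀ i ≥ K, σ i = i

lemma Equiv.Perm.IsFinitary.mul {σ τ : Equiv.Perm ℕ} (hσ : σ.IsFinitary) (hτ : τ.IsFinitary) :
    (σ * τ).IsFinitary := by
  obtain ⟨K, hK⟩ := hσ
  obtain ⟨L, hL⟩ := hτ
  refine ⟨max K L, fun i hi => ?_⟩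
  rw [Equiv.Perm.mul_apply, hL i (le_of_max_le_right hi), hK i (le_of_max_le_left hi)]

lemma Equiv.Perm.isFinitary_swap (a b : ℕ) : (Equiv.swap a b).IsFinitary :=
  ⟨max a b + 1, fun i hi => Equiv.swap_apply_of_ne_of_ne (by omega) (by omega)⟩

/-- An injection of a finite set of natural numbers extends to a finitary permutation. -/
lemma Equiv.Perm.exists_isFinitary_extending (f : ℕ → ℕ) (s : Finset ℕ) (hf : Set.InjOn f s) :
    ∃ σ : Equiv.Perm ℕ, σ.IsFinitary ∧ ∀ i ∈ s, σ i = f i := by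
  classical
  induction s using Finset.induction_on with
  | empty => exact ⟨1, ⟨0, fun _ _ => rfl⟩, by simp⟩
  | insert a s ha ih =>
    obtain ⟨σ, hσ, h⟩ := ih (hf.mono (by simp))
    -- The swap corrects the value at `a` only: for `i ∈ s` the value `f i = σ i` differs from both
    -- `σ a` and `f a`.
    refine ⟨Equiv.swap (σ a) (f a) * σ, (Equiv.Perm.isFinitary_swap _ _).mul hσ, fun i hi => ?_⟩
    rw [Equiv.Perm.mul_apply]
    rcases Finset.mem_insert.1 hi with rfl | hi'
    · exact Equiv.swap_apply_left _ _
    · have hne : i ≠ a := fun h => ha (h ▸ hi')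
      rw [Equiv.swap_apply_of_ne_of_ne (σ.injective.ne hne), h i hi']
      rw [h i hi']
      exact fun hfi => hne (hf (by simp [hi']) (by simp) hfi)

/-! ### Closedness of convergence sets -/

/-- For a sequence of maps with a common Lipschitz constant, the set of points at which it is
Cauchy is closed. -/
lemma isClosed_setOf_cauchySeq {E F : Type*} [PseudoMetricSpace E] [PseudoMetricSpace F]
    {g : ℕ → E → F} {C : NNReal} (hg : ∀ n, LipschitzWith C (g n)) :
    IsClosed {x | CauchySeq fun n => g n x} := by
  refine isClosed_of_closure_subset fun x hx => ?_
  rw [Set.mem_ofPred_eq, Metric.cauchySeq_iff]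
  intro ε hε
  -- `C + 1` instead of `C` keeps the denominator positive when `C = 0`.
  have hδ : 0 < ε / (3 * (C + 1)) := by positivity
  obtain ⟨y, hy, hxy⟩ := Metric.mem_closure_iff.1 hx _ hδ
  obtain ⟨N, hN⟩ := Metric.cauchySeq_iff.1 hy (ε / 3) (by positivity)
  have key : ∀ n, dist (g n x) (g n y) < ε / 3 := fun n => by
    have h1 : dist (g n x) (g n y) ≤ (C + 1) * dist x y :=
      ((hg n).dist_le_mul x y).trans (by nlinarith [dist_nonneg (x := x) (y := y)])
    refine h1.trans_lt ?_
    calc ((C : ℝ) + 1) * dist x y < (C + 1) * (ε / (3 * (C + 1))) := by gcongr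
      _ = ε / 3 := by field_simp
  refine ⟨N, fun m hm n hn => ?_⟩
  have := dist_triangle4 (g m x) (g m y) (g n y) (g n x)
  have h1 := key m
  have h2 := key n
  rw [dist_comm] at h2
  linarith [hN m hm n hn]

noncomputable section

variable {A : Type u} [CStarAlgebra A]

/-! ### Reindexing the free factors -/

/-- The representation with the free factors reindexed. -/
abbrev FreeProdRep.reindex (r : FreeProdRep A) (f : ℕ → ℕ) : FreeProdRep A where
  carrier := r.carrier
  hom i := r.hom (f i)

/-- The `*`-endomorphism of the ambient algebra induced by a map of the index set. -/
def ambientReindex (f : ℕ → ℕ) : FreeProdAmbient A →⋆ₐ[ℂ] FreeProdAmbient A where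
  -- The coordinate at `r` is read off at `r` precomposed with `f`, so the `i`-th copy of `A` goes
  -- to the `f i`-th one by definition.
  toFun x := ⟨fun r => x (r.reindex f), memℓp_infty ⟨‖x‖, by
    rintro _ ⟨r, rfl⟩
    exact lp.norm_apply_le_norm ENNReal.top_ne_zero x (r.reindex f)⟩⟩
  map_one' := rfl
  map_mul' _ _ := rfl
  map_zero' := rfl
  map_add' _ _ := rfl
  commutes' _ := rfl
  map_star' _ := rfl

lemma StarAlgHom.continuous_of_cstar {B C : Type*} [CStarAlgebra B] [CStarAlgebra C]
    (φ : B →⋆ₐ[ℂ] C) : Continuous φ :=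
  AddMonoidHomClass.continuous_of_bound φ 1 fun x => by
    simpa using NonUnitalStarAlgHom.norm_apply_le φ x

namespace FreeProd

/-- The inclusion into the ambient algebra. -/
def toAmbient : FreeProd A →⋆ₐ[ℂ] FreeProdAmbient A := (freeProdSubalgebra A).subtype

lemma ambientReindex_mem (f : ℕ → ℕ) (x : FreeProd A) :
    ambientReindex f (toAmbient x) ∈ freeProdSubalgebra A := by
  have h : freeProdSubalgebra A ≤ (freeProdSubalgebra A).comap (ambientReindex f) := by
    refine StarSubalgebra.topologicalClosure_minimal (StarAlgebra.adjoin_le ?_) ?_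
    · rintro _ hx
      obtain ⟨i, a, rfl⟩ := Set.mem_iUnion.1 hx
      exact StarSubalgebra.le_topologicalClosure _
        (StarAlgebra.subset_adjoin ℂ _ (Set.mem_iUnion.2 ⟨f i, a, rfl⟩))
    · exact IsClosed.preimage (StarAlgHom.continuous_of_cstar (ambientReindex f))
        (StarSubalgebra.isClosed_topologicalClosure _)
  exact h x.2

/-- The `*`-endomorphism of the free product induced by a map of the index set. -/
def reindex (f : ℕ → ℕ) : FreeProd A →⋆ₐ[ℂ] FreeProd A :=
  ((ambientReindex f).comp toAmbient).codRestrict (freeProdSubalgebra A) (ambientReindex_mem f)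

@[simp]
lemma reindex_incl (f : ℕ → ℕ) (i : ℕ) (a : A) : reindex f (incl A i a) = incl A (f i) a := rfl

lemma reindex_reindex (f g : ℕ → ℕ) (x : FreeProd A) :
    reindex f (reindex g x) = reindex (f ∘ g) x := rfl

/-- The `*`-subalgebra generated by the free factors is dense. -/
lemma dense_adjoin_incl :
    (StarAlgebra.adjoin ℂ (⋃ i, Set.range (incl A i))).topologicalClosure = ⊤ := by
  rw [StarSubalgebra.eq_top_iff]
  intro x
  have hind : Topology.IsInducing (toAmbient : FreeProd A → FreeProdAmbient A) :=
    Topology.IsInducing.subtypeVal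
  rw [← SetLike.mem_coe, StarSubalgebra.topologicalClosure_coe,
    hind.closure_eq_preimage_closure_image]
  have hmap : (StarAlgebra.adjoin ℂ (⋃ i, Set.range (incl A i))).map toAmbient =
      StarAlgebra.adjoin ℂ (⋃ i, Set.range (ambientIncl A i)) := by
    rw [StarAlgHom.map_adjoin, Set.image_iUnion]
    congr 1
    exact Set.iUnion_congr fun i => by rw [← Set.range_comp]; rfl
  have hx : toAmbient x ∈ freeProdSubalgebra A := x.2
  rw [freeProdSubalgebra, ← hmap] at hx
  exact hx

/-- The `*`-algebra generated by the first `M` free factors. -/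
def upTo (A : Type u) [CStarAlgebra A] (M : ℕ) : StarSubalgebra ℂ (FreeProd A) :=
  StarAlgebra.adjoin ℂ (⋃ i < M, Set.range (incl A i))

lemma upTo_mono {M N : ℕ} (h : M ≤ N) : upTo A M ≤ upTo A N :=
  StarAlgebra.adjoin_mono (Set.biUnion_subset_biUnion_left fun _ hi => lt_of_lt_of_le hi h)

lemma incl_mem_upTo {i M : ℕ} (h : i < M) (a : A) : incl A i a ∈ upTo A M :=
  StarAlgebra.subset_adjoin ℂ _ (Set.mem_iUnion₂.2 ⟨i, h, a, rfl⟩)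

/-- Closed sets that contain the words in finitely many free factors are everything. -/
lemma mem_of_isClosed {s : Set (FreeProd A)} (hs : IsClosed s) (h : ∀ M, ∀ x ∈ upTo A M, x ∈ s)
    (x : FreeProd A) : x ∈ s := by
  have hx : x ∈ (StarAlgebra.adjoin ℂ (⋃ i, Set.range (incl A i))).topologicalClosure := by
    rw [dense_adjoin_incl]; trivial
  refine closure_minimal (fun y hy => ?_) hs hx
  suffices ∃ M, y ∈ upTo A M from this.elim fun M hM => h M y hM
  induction hy using StarAlgebra.adjoin_induction with
  | mem y hy =>
    obtain ⟨i, a, rfl⟩ := Set.mem_iUnion.1 hy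
    exact ⟨i + 1, incl_mem_upTo (Nat.lt_succ_self i) a⟩
  | algebraMap r => exact ⟨0, algebraMap_mem _ r⟩
  | add y z _ _ hy hz =>
    obtain ⟨M, hM⟩ := hy
    obtain ⟨N, hN⟩ := hz
    exact ⟨max M N, add_mem (upTo_mono (le_max_left _ _) hM) (upTo_mono (le_max_right _ _) hN)⟩
  | mul y z _ _ hy hz =>
    obtain ⟨M, hM⟩ := hy
    obtain ⟨N, hN⟩ := hz
    exact ⟨max M N, mul_mem (upTo_mono (le_max_left _ _) hM) (upTo_mono (le_max_right _ _) hN)⟩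
  | star y _ hy => exact hy.imp fun M hM => star_mem hM

/-- Two `*`-homomorphisms that agree on the first `M` free factors agree on `upTo A M`. -/
lemma eqOn_upTo {B : Type*} [Ring B] [StarRing B] [Algebra ℂ B] [StarModule ℂ B]
    {φ χ : FreeProd A →⋆ₐ[ℂ] B} {M : ℕ} (h : ∀ i < M, ∀ a, φ (incl A i a) = χ (incl A i a))
    {x : FreeProd A} (hx : x ∈ upTo A M) : φ x = χ x := by
  have : upTo A M ≤ StarAlgHom.equalizer φ χ := StarAlgHom.adjoin_le_equalizer _ _ (by
    rintro _ hy
    obtain ⟨i, hi, a, rfl⟩ := Set.mem_iUnion₂.1 hy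
    exact h i hi a)
  exact this hx

lemma reindex_eq_of_mem_upTo {f g : ℕ → ℕ} {M : ℕ} (h : ∀ i < M, f i = g i) {x : FreeProd A}
    (hx : x ∈ upTo A M) : reindex f x = reindex g x :=
  eqOn_upTo (fun i hi a => by simp [h i hi]) hx

lemma reindex_eq_self_of_mem_upTo {f : ℕ → ℕ} {M : ℕ} (h : ∀ i < M, f i = i) {x : FreeProd A}
    (hx : x ∈ upTo A M) : reindex f x = x :=
  reindex_eq_of_mem_upTo (g := id) h hx

/-- The product of a word in the free factors. -/
def word (w : List (ℕ × A)) : FreeProd A := (w.map fun p => incl A p.1 p.2).prod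

lemma reindex_word (f : ℕ → ℕ) (w : List (ℕ × A)) :
    reindex f (word w) = (w.map fun p => incl A (f p.1) p.2).prod := by
  simp [word, map_list_prod, Function.comp_def]

/-- The linear span of the words is dense. -/
lemma dense_span_word :
    Dense (Submodule.span ℂ (Set.range (word (A := A))) : Set (FreeProd A)) := by
  have h : (StarAlgebra.adjoin ℂ (⋃ i, Set.range (incl A i)) : Set (FreeProd A)) ⊆
      Submodule.span ℂ (Set.range (word (A := A))) := by
    intro x hx
    rw [SetLike.mem_coe, ← StarSubalgebra.mem_toSubalgebra, ← Subalgebra.mem_toSubmodule,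
      StarAlgebra.adjoin_eq_span] at hx
    refine Submodule.span_mono (fun y hy => ?_) hx
    induction hy using Submonoid.closure_induction with
    | one => exact ⟨[], rfl⟩
    | mem y hy =>
      rcases hy with hy | hy
      · obtain ⟨i, a, rfl⟩ := Set.mem_iUnion.1 hy
        exact ⟨[(i, a)], by simp [word]⟩
      · obtain ⟨i, a, ha⟩ := Set.mem_iUnion.1 (Set.mem_star.1 hy)
        exact ⟨[(i, star a)], by simp [word, map_star, ha]⟩
    | mul y z _ _ hy hz =>
      obtain ⟨v, rfl⟩ := hy
      obtain ⟨w, rfl⟩ := hz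
      exact ⟨v ++ w, by simp [word]⟩
  intro x
  refine closure_mono h ?_
  rw [← StarSubalgebra.topologicalClosure_coe, dense_adjoin_incl]
  trivial

/-- Closed linear conditions hold everywhere if they hold on words. -/
lemma mem_of_word_mem {S : Submodule ℂ (FreeProd A)} (hS : IsClosed (S : Set (FreeProd A)))
    (h : ∀ w, word w ∈ S) (x : FreeProd A) : x ∈ S :=
  closure_minimal (Submodule.span_le.2 (by rintro _ ⟨w, rfl⟩; exact h w)) hS (dense_span_word x)

end FreeProd
end

noncomputable section

variable {A : Type u} [CStarAlgebra A]

/-! ### Vectors and intertwiners of GNS representations -/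

section GNS

variable (ψ φ : FreeProd A →ₚ[ℂ] ℂ)

/-- The class of an element in the GNS space. -/
def gnsVec : FreeProd A →ₗ[ℂ] ψ.GNS where
  toFun x := ((ψ.toPreGNS x : ψ.PreGNS) : ψ.GNS)
  map_add' x y := by rw [map_add, UniformSpace.Completion.coe_add]
  map_smul' c x := by rw [map_smul, UniformSpace.Completion.coe_smul]; rfl

lemma gnsVec_one : gnsVec ψ 1 = gnsVacuum ψ := rfl

lemma inner_gnsVec (x y : FreeProd A) : ⟪gnsVec ψ x, gnsVec ψ y⟫_ℂ = ψ (star x * y) :=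
  UniformSpace.Completion.inner_coe _ _

lemma gnsStarAlgHom_gnsVec (x y : FreeProd A) :
    ψ.gnsStarAlgHom x (gnsVec ψ y) = gnsVec ψ (x * y) :=
  ψ.gnsNonUnitalStarAlgHom_apply_coe (a := x) (b := ψ.toPreGNS y)

lemma denseRange_gnsVec : DenseRange (gnsVec ψ) :=
  UniformSpace.Completion.denseRange_coe (α := ψ.PreGNS)

variable {ψ φ} in
/-- Operators on the GNS space that agree on the classes of the elements are equal. -/
lemma ext_gnsVec {F : Type*} [NormedAddCommGroup F] [NormedSpace ℂ F] {S T : ψ.GNS →L[ℂ] F}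
    (h : ∀ x, S (gnsVec ψ x) = T (gnsVec ψ x)) : S = T :=
  DFunLike.coe_injective
    ((denseRange_gnsVec ψ).equalizer S.continuous T.continuous (funext h))

variable {ψ} in
lemma vacuumState_gnsStarAlgHom (x : FreeProd A) :
    vacuumState ψ (ψ.gnsStarAlgHom x) = ψ x := by
  change ⟪gnsVec ψ 1, ψ.gnsStarAlgHom x (gnsVec ψ 1)⟫_ℂ = _
  rw [gnsStarAlgHom_gnsVec, inner_gnsVec]
  simp

/-- A linear map that is bounded with respect to the GNS seminorms induces an operator between
the GNS spaces. -/
def gnsMap (T : FreeProd A →ₗ[ℂ] FreeProd A) (C : ℝ)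
    (h : ∀ x, φ (star (T x) * T x) ≤ C * ψ (star x * x)) : ψ.GNS →L[ℂ] φ.GNS :=
  ((φ.toPreGNS.toLinearMap ∘ₗ T ∘ₗ ψ.ofPreGNS.toLinearMap).mkContinuous √C fun x => by
    have h1 := (Complex.le_def.1 (h (ψ.ofPreGNS x))).1
    rw [Complex.re_ofReal_mul] at h1
    have h2 : 0 ≤ (ψ (star (ψ.ofPreGNS x) * ψ.ofPreGNS x)).re :=
      (Complex.le_def.1 (ψ.map_nonneg (star_mul_self_nonneg _))).1
    rw [PositiveLinearMap.preGNS_norm_def, PositiveLinearMap.preGNS_norm_def,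
      -- Nonnegativity of the second factor suffices to split the root, so no sign of `C` is needed.
      ← Real.sqrt_mul' _ h2]
    exact Real.sqrt_le_sqrt h1).completion

@[simp]
lemma gnsMap_gnsVec (T : FreeProd A →ₗ[ℂ] FreeProd A) (C : ℝ)
    (h : ∀ x, φ (star (T x) * T x) ≤ C * ψ (star x * x)) (x : FreeProd A) :
    gnsMap ψ φ T C h (gnsVec ψ x) = gnsVec φ (T x) :=
  ContinuousLinearMap.completion_apply_coe _ _

end GNS

/-! ### Permutations of the free factors on the GNS space -/

/-- A functional on the free product is invariant under permutations of the free factors. -/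
def IsPermInvariant (ψ : FreeProd A →ₚ[ℂ] ℂ) : Prop :=
  ∀ (σ : Equiv.Perm ℕ) (x : FreeProd A), ψ (FreeProd.reindex σ x) = ψ x

/-- Positivity gives continuity: the functional is a vector functional of its GNS representation,
and `*`-homomorphisms of C⋆-algebras are contractive. -/
lemma continuous_of_nonneg (ψ : FreeProd A →ₚ[ℂ] ℂ) : Continuous ψ := by
  have : (ψ : FreeProd A → ℂ) = fun x => vacuumState ψ (ψ.gnsStarAlgHom x) :=
    funext fun x => (vacuumState_gnsStarAlgHom x).symm
  rw [this]
  have hc := StarAlgHom.continuous_of_cstar ψ.gnsStarAlgHom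
  change Continuous fun x => ⟪gnsVacuum ψ, ψ.gnsStarAlgHom x (gnsVacuum ψ)⟫_ℂ
  fun_prop

lemma isPermInvariant_of_mem_symmetricStates {ψ : FreeProd A →ₚ[ℂ] ℂ}
    (hψ : ψ.toLinearMap ∈ symmetricStates A) : IsPermInvariant ψ := by
  intro σ x
  have hc := (continuous_of_nonneg ψ).comp
    (StarAlgHom.continuous_of_cstar (FreeProd.reindex (A := A) σ))
  let S : Submodule ℂ (FreeProd A) := LinearMap.eqLocus
    (ψ.toLinearMap ∘ₗ (FreeProd.reindex σ).toAlgHom.toLinearMap) ψ.toLinearMap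
  have hS : IsClosed (S : Set (FreeProd A)) := isClosed_eq hc (continuous_of_nonneg ψ)
  refine FreeProd.mem_of_word_mem hS (fun w => ?_) x
  exact (congrArg ψ (FreeProd.reindex_word σ w)).trans (hψ.2 σ w).symm

section Perm

variable {ψ : FreeProd A →ₚ[ℂ] ℂ} (hψ : IsPermInvariant ψ)

/-- The unitary on the GNS space implementing a permutation of the free factors. -/
def gnsPerm (σ : Equiv.Perm ℕ) : GNSOp ψ :=
  gnsMap ψ ψ (FreeProd.reindex σ).toAlgHom.toLinearMap 1 fun x => by
    rw [Complex.ofReal_one, one_mul]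
    refine le_of_eq ((congrArg ψ ?_).trans (hψ σ (star x * x)))
    rw [map_mul, map_star]
    rfl

@[simp]
lemma gnsPerm_gnsVec (σ : Equiv.Perm ℕ) (x : FreeProd A) :
    gnsPerm hψ σ (gnsVec ψ x) = gnsVec ψ (FreeProd.reindex σ x) :=
  gnsMap_gnsVec _ _ _ _ _ _

lemma gnsPerm_mul (σ τ : Equiv.Perm ℕ) : gnsPerm hψ σ * gnsPerm hψ τ = gnsPerm hψ (σ * τ) :=
  ext_gnsVec fun x => by
    rw [mul_apply_eq_comp]
    simp [FreeProd.reindex_reindex, Equiv.Perm.coe_mul]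

lemma gnsPerm_one : gnsPerm hψ 1 = 1 :=
  ext_gnsVec fun x => by
    rw [gnsPerm_gnsVec]
    rfl

lemma star_gnsPerm (σ : Equiv.Perm ℕ) : star (gnsPerm hψ σ) = gnsPerm hψ σ⁻¹ := by
  rw [ContinuousLinearMap.star_eq_adjoint]
  refine ext_gnsVec fun x => ?_
  refine (denseRange_gnsVec ψ).eq_of_inner_left ℂ fun y => ?_
  rw [ContinuousLinearMap.adjoint_inner_left, gnsPerm_gnsVec, gnsPerm_gnsVec, inner_gnsVec,
    inner_gnsVec, ← hψ σ (star (FreeProd.reindex _ x) * y),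
    map_mul (FreeProd.reindex _), map_star (FreeProd.reindex _),
    FreeProd.reindex_reindex, ← Equiv.Perm.coe_mul,
    mul_inv_cancel]
  rfl

lemma gnsPerm_mul_gnsStarAlgHom (σ : Equiv.Perm ℕ) (x : FreeProd A) :
    gnsPerm hψ σ * ψ.gnsStarAlgHom x =
      ψ.gnsStarAlgHom (FreeProd.reindex σ x) * gnsPerm hψ σ :=
  ext_gnsVec fun y => by
    rw [mul_apply_eq_comp, mul_apply_eq_comp, gnsStarAlgHom_gnsVec,
      gnsPerm_gnsVec, gnsPerm_gnsVec, gnsStarAlgHom_gnsVec, map_mul]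

/-- Conjugation by the unitary implementing a permutation of the free factors. -/
def gnsConj (σ : Equiv.Perm ℕ) : GNSOp ψ →⋆ₐ[ℂ] GNSOp ψ where
  toFun T := gnsPerm hψ σ * T * gnsPerm hψ σ⁻¹
  map_one' := by simp [gnsPerm_mul, gnsPerm_one]
  map_mul' S T := by
    have h : gnsPerm hψ σ⁻¹ * gnsPerm hψ σ = 1 := by simp [gnsPerm_mul, gnsPerm_one]
    simp only [mul_assoc]
    rw [← mul_assoc (gnsPerm hψ σ⁻¹) (gnsPerm hψ σ), h, one_mul]
  map_zero' := by simp
  map_add' S T := by simp [mul_add, add_mul]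
  commutes' c := by
    rw [← Algebra.commutes, mul_assoc, gnsPerm_mul, mul_inv_cancel, gnsPerm_one, mul_one]
  map_star' T := by simp [star_gnsPerm, mul_assoc]

lemma gnsConj_apply (σ : Equiv.Perm ℕ) (T : GNSOp ψ) :
    gnsConj hψ σ T = gnsPerm hψ σ * T * gnsPerm hψ σ⁻¹ := rfl

lemma gnsConj_gnsConj (σ τ : Equiv.Perm ℕ) (T : GNSOp ψ) :
    gnsConj hψ σ (gnsConj hψ τ T) = gnsConj hψ (σ * τ) T := by
  simp only [gnsConj_apply, mul_inv_rev, ← gnsPerm_mul, mul_assoc]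

@[simp]
lemma gnsConj_gnsStarAlgHom (σ : Equiv.Perm ℕ) (x : FreeProd A) :
    gnsConj hψ σ (ψ.gnsStarAlgHom x) = ψ.gnsStarAlgHom (FreeProd.reindex σ x) := by
  rw [gnsConj_apply, gnsPerm_mul_gnsStarAlgHom, mul_assoc, gnsPerm_mul, mul_inv_cancel,
    gnsPerm_one, mul_one]

/-- U_σ π_i(a) = π_{σ(i)}(a) U_σ, and σ(i) = i for i ≥ K. -/
lemma gnsPerm_mem_centralizer {σ : Equiv.Perm ℕ} {K : ℕ} (hσ : ∀ i ≥ K, σ i = i) :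
    gnsPerm hψ σ ∈ StarSubalgebra.centralizer ℂ (⋃ i ≥ K, Set.range (gnsFactor ψ i)) := by
  have key : ∀ i ≥ K, ∀ a : A,
      gnsFactor ψ i a * gnsPerm hψ σ = gnsPerm hψ σ * gnsFactor ψ i a := fun i hi a => by
    have := gnsPerm_mul_gnsStarAlgHom hψ σ (FreeProd.incl A i a)
    rw [FreeProd.reindex_incl, hσ i hi] at this
    exact this.symm
  rw [StarSubalgebra.mem_centralizer_iff]
  intro g hg
  obtain ⟨i, hi, a, rfl⟩ := Set.mem_iUnion₂.1 hg
  exact ⟨key i hi a, by rw [← map_star]; exact key i hi (star a)⟩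

/-- The tail algebra lies in the double commutant of the factors of index at least K, and U_σ lies
in their commutant. This is where finitariness enters. -/
lemma commute_gnsPerm_of_mem_tailAlgebra {σ : Equiv.Perm ℕ} (hσ : σ.IsFinitary) {T : GNSOp ψ}
    (hT : T ∈ tailAlgebra ψ) : gnsPerm hψ σ * T = T * gnsPerm hψ σ := by
  obtain ⟨K, hK⟩ := hσ
  have h1 := StarSubalgebra.mem_iInf.1 hT K
  rw [generatedVN, StarSubalgebra.mem_centralizer_iff] at h1
  exact (h1 _ (gnsPerm_mem_centralizer hψ hK)).1

lemma gnsConj_of_mem_tailAlgebra {σ : Equiv.Perm ℕ} (hσ : σ.IsFinitary) {T : GNSOp ψ}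
    (hT : T ∈ tailAlgebra ψ) : gnsConj hψ σ T = T := by
  rw [gnsConj_apply, commute_gnsPerm_of_mem_tailAlgebra hψ hσ hT, mul_assoc, gnsPerm_mul,
    mul_inv_cancel, gnsPerm_one, mul_one]

lemma gnsConj_mem_tailExtension {σ : Equiv.Perm ℕ} (hσ : σ.IsFinitary) {T : GNSOp ψ}
    (hT : T ∈ tailExtension ψ) : gnsConj hψ σ T ∈ tailExtension ψ := by
  have h : tailExtension ψ ≤ (tailExtension ψ).comap (gnsConj hψ σ) := by
    refine StarSubalgebra.topologicalClosure_minimal (StarAlgebra.adjoin_le ?_) ?_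
    · intro y hy
      rw [SetLike.mem_coe, StarSubalgebra.mem_comap]
      refine StarSubalgebra.le_topologicalClosure _ (StarAlgebra.subset_adjoin ℂ _ ?_)
      rcases hy with ⟨x, rfl⟩ | hy
      · rw [gnsConj_gnsStarAlgHom]
        exact Or.inl ⟨_, rfl⟩
      · rw [gnsConj_of_mem_tailAlgebra hψ hσ hy]
        exact Or.inr hy
    · exact IsClosed.preimage (StarAlgHom.continuous_of_cstar (gnsConj hψ σ))
        (StarSubalgebra.isClosed_topologicalClosure _)
  exact h hT

lemma gnsPerm_gnsVec_of_mem_upTo {σ : Equiv.Perm ℕ} {M : ℕ} (hσ : ∀ i < M, σ i = i)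
    {x : FreeProd A} (hx : x ∈ FreeProd.upTo A M) :
    gnsPerm hψ σ (gnsVec ψ x) = gnsVec ψ x := by
  rw [gnsPerm_gnsVec, FreeProd.reindex_eq_self_of_mem_upTo hσ hx]

/-- Matrix coefficients are invariant under permutations that fix the vectors. -/
lemma inner_gnsConj {σ : Equiv.Perm ℕ} {M : ℕ} (hσ : ∀ i < M, σ i = i)
    {x y : FreeProd A} (hx : x ∈ FreeProd.upTo A M) (hy : y ∈ FreeProd.upTo A M) (T : GNSOp ψ) :
    ⟪gnsVec ψ x, gnsConj hψ σ T (gnsVec ψ y)⟫_ℂ = ⟪gnsVec ψ x, T (gnsVec ψ y)⟫_ℂ := by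
  have hσ' : ∀ i < M, σ⁻¹ i = i := fun i hi => Equiv.Perm.inv_eq_iff_eq.2 (hσ i hi).symm
  have h : gnsPerm hψ σ = ContinuousLinearMap.adjoint (gnsPerm hψ σ⁻¹) := by
    rw [← ContinuousLinearMap.star_eq_adjoint, star_gnsPerm, inv_inv]
  rw [gnsConj_apply, mul_apply_eq_comp, mul_apply_eq_comp,
    gnsPerm_gnsVec_of_mem_upTo hψ hσ' hy, h, ContinuousLinearMap.adjoint_inner_right,
    gnsPerm_gnsVec_of_mem_upTo hψ hσ' hx]

end Perm

/-! ### The shift of the extension by the tail algebra -/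

section Extension

variable (ψ : FreeProd A →ₚ[ℂ] ℂ)

/-- The `*`-algebra generated by the first `M` free factors and the tail algebra. -/
def partialExtension (M : ℕ) : StarSubalgebra ℂ (GNSOp ψ) :=
  StarAlgebra.adjoin ℂ (ψ.gnsStarAlgHom '' FreeProd.upTo A M ∪ (tailAlgebra ψ : Set (GNSOp ψ)))

lemma partialExtension_mono {M N : ℕ} (h : M ≤ N) :
    partialExtension ψ M ≤ partialExtension ψ N :=
  StarAlgebra.adjoin_mono (Set.union_subset_union_left _ (Set.image_mono (FreeProd.upTo_mono h)))

lemma gnsStarAlgHom_mem_partialExtension {M : ℕ} {x : FreeProd A} (hx : x ∈ FreeProd.upTo A M) :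
    ψ.gnsStarAlgHom x ∈ partialExtension ψ M :=
  StarAlgebra.subset_adjoin ℂ _ (Or.inl ⟨x, hx, rfl⟩)

lemma tailAlgebra_le_partialExtension (M : ℕ) : tailAlgebra ψ ≤ partialExtension ψ M :=
  fun _ hx => StarAlgebra.subset_adjoin ℂ _ (Or.inr hx)

lemma tailAlgebra_le_tailExtension : tailAlgebra ψ ≤ tailExtension ψ :=
  fun _ hx => StarSubalgebra.le_topologicalClosure _ (StarAlgebra.subset_adjoin ℂ _ (Or.inr hx))

lemma partialExtension_le_tailExtension (M : ℕ) : partialExtension ψ M ≤ tailExtension ψ := by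
  refine StarAlgebra.adjoin_le ?_
  rintro _ (⟨x, -, rfl⟩ | hx)
  · exact (gnsToExtension ψ x).2
  · exact tailAlgebra_le_tailExtension ψ hx

/-- The partial extensions are dense in the extension. -/
lemma tailExtension_subset_of_isClosed {s : Set (GNSOp ψ)} (hs : IsClosed s)
    (h : ∀ M, (partialExtension ψ M : Set (GNSOp ψ)) ⊆ s) :
    (tailExtension ψ : Set (GNSOp ψ)) ⊆ s := by
  let C : StarSubalgebra ℂ (GNSOp ψ) := ⨆ M, partialExtension ψ M
  have hdir : Directed (· ≤ ·) (partialExtension ψ) :=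
    Monotone.directed_le fun _ _ h => partialExtension_mono ψ h
  have hC : (C : Set (GNSOp ψ)) = ⋃ M, (partialExtension ψ M : Set (GNSOp ψ)) :=
    StarSubalgebra.coe_iSup_of_directed hdir
  have hle : tailExtension ψ ≤ C.topologicalClosure := by
    refine StarSubalgebra.topologicalClosure_minimal (StarAlgebra.adjoin_le ?_)
      (StarSubalgebra.isClosed_topologicalClosure _)
    rintro _ (⟨x, rfl⟩ | hx)
    · refine FreeProd.mem_of_isClosed (s := ψ.gnsStarAlgHom ⁻¹' C.topologicalClosure)
        (IsClosed.preimage (StarAlgHom.continuous_of_cstar ψ.gnsStarAlgHom)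
          (StarSubalgebra.isClosed_topologicalClosure _)) (fun M x hx => ?_) x
      exact StarSubalgebra.le_topologicalClosure _
        ((le_iSup (partialExtension ψ) M) (gnsStarAlgHom_mem_partialExtension ψ hx))
    · exact StarSubalgebra.le_topologicalClosure _
        ((le_iSup (partialExtension ψ) 0) (tailAlgebra_le_partialExtension ψ 0 hx))
  intro x hx
  refine closure_minimal ?_ hs (hle hx)
  rw [hC]
  exact Set.iUnion_subset h

end Extension
end

noncomputable section

variable {A : Type u} [CStarAlgebra A]

/-! ### Existence, uniqueness and iterates of the tail shift -/

section Shift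

variable (ψ : FreeProd A →ₚ[ℂ] ℂ)

instance : IsClosed (tailExtension ψ : Set (GNSOp ψ)) :=
  StarSubalgebra.isClosed_topologicalClosure _

/-- Closed conditions on the extension hold if they hold on the partial extensions. -/
lemma mem_of_isClosed_of_partialExtension {s : Set (tailExtension ψ)} (hs : IsClosed s)
    (h : ∀ M, ∀ x : tailExtension ψ, (x : GNSOp ψ) ∈ partialExtension ψ M → x ∈ s)
    (x : tailExtension ψ) : x ∈ s := by
  have hcl : IsClosed (Subtype.val '' s : Set (GNSOp ψ)) :=
    (StarSubalgebra.isClosed_topologicalClosure _ : IsClosed (tailExtension ψ : Set (GNSOp ψ)))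
      |>.isClosedEmbedding_subtypeVal.isClosedMap _ hs
  obtain ⟨y, hy, hyx⟩ := tailExtension_subset_of_isClosed ψ hcl
    (fun M y hy => ⟨⟨y, partialExtension_le_tailExtension ψ M hy⟩, h M _ hy, rfl⟩) x.2
  rwa [← Subtype.ext hyx]

variable {ψ}

lemma coe_gnsToExtension (x : FreeProd A) :
    (gnsToExtension ψ x : GNSOp ψ) = ψ.gnsStarAlgHom x := rfl

/-- Two `*`-homomorphisms on the extension that agree on the first `M` free factors and on the tail
algebra agree on the partial extension. -/
lemma eq_of_mem_partialExtension {β γ : tailExtension ψ →⋆ₐ[ℂ] GNSOp ψ} {M : ℕ}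
    (h : ∀ x ∈ FreeProd.upTo A M, β (gnsToExtension ψ x) = γ (gnsToExtension ψ x))
    (h' : ∀ x : tailExtension ψ, (x : GNSOp ψ) ∈ tailAlgebra ψ → β x = γ x)
    (x : tailExtension ψ) (hx : (x : GNSOp ψ) ∈ partialExtension ψ M) : β x = γ x := by
  have hle : partialExtension ψ M ≤ (StarAlgHom.equalizer β γ).map (tailExtension ψ).subtype := by
    refine StarAlgebra.adjoin_le fun y hy => ?_
    rcases hy with ⟨z, hz, rfl⟩ | hy
    · exact ⟨gnsToExtension ψ z, h z hz, rfl⟩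
    · exact ⟨⟨y, tailAlgebra_le_tailExtension ψ hy⟩, h' _ hy, rfl⟩
  obtain ⟨y, hy, hyx⟩ := hle hx
  obtain rfl : y = x := Subtype.ext hyx
  exact hy

lemma StarAlgHom.exists_iterate {B : Type*} [Ring B] [StarRing B] [Algebra ℂ B]
    (α : B →⋆ₐ[ℂ] B) (n : ℕ) : ∃ β : B →⋆ₐ[ℂ] B, ∀ x, β x = α^[n] x := by
  induction n with
  | zero => exact ⟨StarAlgHom.id ℂ B, fun _ => rfl⟩
  | succ n ih =>
    obtain ⟨β, hβ⟩ := ih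
    exact ⟨β.comp α, fun x => hβ (α x)⟩

lemma norm_iterate_le (α : tailExtension ψ →⋆ₐ[ℂ] tailExtension ψ) (n : ℕ)
    (x : tailExtension ψ) : ‖(α^[n] x : GNSOp ψ)‖ ≤ ‖x‖ := by
  obtain ⟨β, hβ⟩ := StarAlgHom.exists_iterate α n
  rw [← hβ]
  exact NonUnitalStarAlgHom.norm_apply_le β x

namespace IsTailShift

variable {α : tailExtension ψ →⋆ₐ[ℂ] tailExtension ψ} (hα : IsTailShift ψ α)

include hα

lemma apply_gnsToExtension (x : FreeProd A) :
    α (gnsToExtension ψ x) = gnsToExtension ψ (FreeProd.reindex Nat.succ x) := by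
  have hs : IsClosed {x : FreeProd A | α (gnsToExtension ψ x) =
      gnsToExtension ψ (FreeProd.reindex Nat.succ x)} :=
    isClosed_eq (StarAlgHom.continuous_of_cstar (α.comp (gnsToExtension ψ)))
      (StarAlgHom.continuous_of_cstar ((gnsToExtension ψ).comp (FreeProd.reindex Nat.succ)))
  refine FreeProd.mem_of_isClosed hs (fun M x hx => ?_) x
  refine FreeProd.eqOn_upTo (φ := α.comp (gnsToExtension ψ))
    (χ := (gnsToExtension ψ).comp (FreeProd.reindex Nat.succ)) (fun i _ a => ?_) hx
  exact Subtype.ext (hα.1 i a _ rfl)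

lemma iterate_gnsToExtension (n : ℕ) (x : FreeProd A) :
    α^[n] (gnsToExtension ψ x) = gnsToExtension ψ (FreeProd.reindex (· + n) x) := by
  induction n with
  | zero => rfl
  | succ n ih =>
    rw [Function.iterate_succ_apply', ih, hα.apply_gnsToExtension, FreeProd.reindex_reindex]
    rfl

lemma iterate_of_mem_tailAlgebra (n : ℕ) {x : tailExtension ψ}
    (hx : (x : GNSOp ψ) ∈ tailAlgebra ψ) : α^[n] x = x :=
  Function.iterate_fixed (hα.2 x hx) n

/-- The powers of the shift are implemented on partial extensions by finitary permutations. -/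
lemma iterate_eq_gnsConj (hψ : IsPermInvariant ψ) {n M : ℕ} {σ : Equiv.Perm ℕ}
    (hσ : σ.IsFinitary) (h : ∀ i < M, σ i = i + n) {x : tailExtension ψ}
    (hx : (x : GNSOp ψ) ∈ partialExtension ψ M) :
    (α^[n] x : GNSOp ψ) = gnsConj hψ σ x := by
  obtain ⟨β, hβ⟩ := StarAlgHom.exists_iterate α n
  rw [← hβ]
  refine eq_of_mem_partialExtension (β := (tailExtension ψ).subtype.comp β)
    (γ := (gnsConj hψ σ).comp (tailExtension ψ).subtype) (fun y hy => ?_) (fun y hy => ?_) x hx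
  · change (β _ : GNSOp ψ) = gnsConj hψ σ (ψ.gnsStarAlgHom y)
    rw [hβ, hα.iterate_gnsToExtension, gnsConj_gnsStarAlgHom, coe_gnsToExtension,
      FreeProd.reindex_eq_of_mem_upTo h hy]
  · change (β _ : GNSOp ψ) = gnsConj hψ σ y
    rw [hβ, hα.iterate_of_mem_tailAlgebra n hy, gnsConj_of_mem_tailAlgebra hψ hσ hy]

end IsTailShift

lemma IsTailShift.ext {α β : tailExtension ψ →⋆ₐ[ℂ] tailExtension ψ} (hα : IsTailShift ψ α)
    (hβ : IsTailShift ψ β) : α = β := by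
  refine StarAlgHom.ext fun x => ?_
  refine mem_of_isClosed_of_partialExtension ψ (s := {x | α x = β x})
    (isClosed_eq (StarAlgHom.continuous_of_cstar α) (StarAlgHom.continuous_of_cstar β))
    (fun M y hy => Subtype.ext ?_) x
  refine eq_of_mem_partialExtension (β := (tailExtension ψ).subtype.comp α)
    (γ := (tailExtension ψ).subtype.comp β) (fun z _ => ?_) (fun z hz => ?_) y hy
  · change (α _ : GNSOp ψ) = β _
    rw [hα.apply_gnsToExtension, hβ.apply_gnsToExtension]
  · change (α _ : GNSOp ψ) = β _
    rw [hα.2 z hz, hβ.2 z hz]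

/-- The tail shift exists: it is the pointwise norm limit of conjugations by permutations. -/
lemma exists_isTailShift (hψ : IsPermInvariant ψ) :
    ∃ α : tailExtension ψ →⋆ₐ[ℂ] tailExtension ψ, IsTailShift ψ α := by
  -- The successor map is not a permutation of `ℕ`, but on each initial segment it agrees with a
  -- finitary one.
  choose σ hσ hσ' using fun N : ℕ => Equiv.Perm.exists_isFinitary_extending Nat.succ
    (Finset.range N) Nat.succ_injective.injOn
  let γ (N : ℕ) : tailExtension ψ →⋆ₐ[ℂ] tailExtension ψ :=
    ((gnsConj hψ (σ N)).comp (tailExtension ψ).subtype).codRestrict (tailExtension ψ)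
      fun x => gnsConj_mem_tailExtension hψ (hσ N) x.2
  have hγ : ∀ N, LipschitzWith 1 (γ N) := fun N =>
    AddMonoidHomClass.lipschitz_of_bound (γ N) 1 (fun x => by
      simpa using NonUnitalStarAlgHom.norm_apply_le (γ N) x) |>.weaken (by simp)
  have hγ1 : ∀ (M : ℕ), ∀ x ∈ FreeProd.upTo A M, ∀ N ≥ M,
      γ N (gnsToExtension ψ x) = gnsToExtension ψ (FreeProd.reindex Nat.succ x) := by
    intro M x hx N hN
    refine Subtype.ext ((gnsConj_gnsStarAlgHom hψ (σ N) x).trans ?_)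
    rw [FreeProd.reindex_eq_of_mem_upTo
      (fun i hi => hσ' N i (Finset.mem_range.2 (hi.trans_le hN))) hx]
    rfl
  have hγ2 : ∀ x : tailExtension ψ, (x : GNSOp ψ) ∈ tailAlgebra ψ → ∀ N, γ N x = x :=
    fun x hx N => Subtype.ext (gnsConj_of_mem_tailAlgebra hψ (hσ N) hx)
  -- On a partial extension the sequence is constant from `N = M` on; the common Lipschitz constant
  -- carries the Cauchy property to the closure.
  have hcauchy : ∀ x, CauchySeq fun N => γ N x := by
    refine mem_of_isClosed_of_partialExtension ψ (isClosed_setOf_cauchySeq hγ) fun M x hx => ?_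
    refine (tendsto_atTop_of_eventually_const (i₀ := M) (x := γ M x) fun N hN => ?_).cauchySeq
    refine Subtype.ext ?_
    refine eq_of_mem_partialExtension (β := (tailExtension ψ).subtype.comp (γ N))
      (γ := (tailExtension ψ).subtype.comp (γ M)) (fun z hz => ?_) (fun z hz => ?_) x hx
    · exact congrArg Subtype.val ((hγ1 M z hz N hN).trans (hγ1 M z hz M le_rfl).symm)
    · exact congrArg Subtype.val ((hγ2 z hz N).trans (hγ2 z hz M).symm)
  choose f hf using fun x => cauchySeq_tendsto_of_complete (hcauchy x)
  have huniq : ∀ {x y}, Filter.Tendsto (fun N => γ N x) Filter.atTop (𝓝 y) → f x = y :=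
    fun {x _} h => tendsto_nhds_unique (hf x) h
  let α : tailExtension ψ →⋆ₐ[ℂ] tailExtension ψ :=
    { toFun := f
      map_one' := huniq (by simp)
      map_mul' := fun x y => huniq (by simpa using (hf x).mul (hf y))
      map_zero' := huniq (by simp)
      map_add' := fun x y => huniq (by simpa using (hf x).add (hf y))
      commutes' := fun c => huniq (by simp only [AlgHomClass.commutes]; exact tendsto_const_nhds)
      map_star' := fun x => huniq (by simpa only [map_star] using (hf x).star) }
  refine ⟨α, fun i a x hx => ?_, fun x hx => huniq ?_⟩
  · obtain rfl : x = gnsToExtension ψ (FreeProd.incl A i a) := Subtype.ext hx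
    have : f (gnsToExtension ψ (FreeProd.incl A i a)) =
        gnsToExtension ψ (FreeProd.incl A (i + 1) a) :=
      huniq (tendsto_atTop_of_eventually_const (i₀ := i + 1) fun N hN =>
        hγ1 (i + 1) _ (FreeProd.incl_mem_upTo (Nat.lt_succ_self i) a) N hN)
    exact congrArg Subtype.val this
  · simp only [hγ2 x hx]
    exact tendsto_const_nhds

lemma isTailShift_tailShift (hψ : IsPermInvariant ψ) : IsTailShift ψ (tailShift ψ) :=
  Classical.epsilon_spec (exists_isTailShift hψ)

end Shift
end

noncomputable section

/-! ### Weak limits of bounded sequences of operators -/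

/-- A bounded sequence of operators with convergent matrix coefficients has a weak limit. -/
lemma exists_weak_limit {H : Type*} [NormedAddCommGroup H] [InnerProductSpace ℂ H]
    [CompleteSpace H] (T : ℕ → H →L[ℂ] H) (C : ℝ) (hT : ∀ n, ‖T n‖ ≤ C)
    (hc : ∀ v w, CauchySeq fun n => ⟪T n w, v⟫_ℂ) :
    ∃ L : H →L[ℂ] H, ∀ v w,
      Filter.Tendsto (fun n => ⟪v, T n w⟫_ℂ) Filter.atTop (𝓝 ⟪v, L w⟫_ℂ) := by
  choose B hB using fun w v => cauchySeq_tendsto_of_complete (hc v w)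
  have huniq : ∀ {w v z}, Filter.Tendsto (fun n => ⟪T n w, v⟫_ℂ) Filter.atTop (𝓝 z) →
      B w v = z := fun {w v _} h => tendsto_nhds_unique (hB w v) h
  let B' : H →ₗ⋆[ℂ] H →ₗ[ℂ] ℂ := LinearMap.mk₂'ₛₗ (starRingEnd ℂ) (RingHom.id ℂ) B
    (fun v w z => huniq (by simpa [inner_add_left] using (hB v z).add (hB w z)))
    (fun c v z => huniq (by
      simpa [inner_smul_left, mul_comm] using (hB v z).const_mul (starRingEnd ℂ c)))
    (fun v w z => huniq (by simpa [inner_add_right] using (hB v w).add (hB v z)))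
    (fun c v z => huniq (by simpa [inner_smul_right] using (hB v z).const_mul c))
  have hbound : ∀ v w, ‖B' v w‖ ≤ C * ‖v‖ * ‖w‖ := fun v w => by
    refine le_of_tendsto (hB v w).norm (Filter.Eventually.of_forall fun n => ?_)
    refine (norm_inner_le_norm _ _).trans ?_
    gcongr
    exact (T n).le_of_opNorm_le (hT n) v
  refine ⟨InnerProductSpace.continuousLinearMapOfBilin (B'.mkContinuous₂ C hbound), fun v w => ?_⟩
  -- `B` has the moving vector `T n w` in the conjugate-linear slot, while the claim has it on the
  -- right; conjugation exchanges the two.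
  have h1 := (hB w v).star
  have h2 : star (B w v) =
      ⟪v, InnerProductSpace.continuousLinearMapOfBilin (B'.mkContinuous₂ C hbound) w⟫_ℂ := by
    rw [← inner_conj_symm, InnerProductSpace.continuousLinearMapOfBilin_apply]
    rfl
  rw [h2] at h1
  simpa using h1

lemma isClosed_centralizer_starSubalgebra {H : Type*} [NormedAddCommGroup H]
    [InnerProductSpace ℂ H] [CompleteSpace H] (S : Set (H →L[ℂ] H)) :
    IsClosed (StarSubalgebra.centralizer ℂ S : Set (H →L[ℂ] H)) := by
  rw [StarSubalgebra.coe_centralizer]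
  exact Set.isClosed_centralizer _

variable {A : Type u} [CStarAlgebra A]

/-! ### Weak convergence of the orbits of the shift, with limits in the tail algebra -/

section Expectation

variable {ψ : FreeProd A →ₚ[ℂ] ℂ}

lemma continuous_gnsVec : Continuous (gnsVec ψ) := by
  have : (gnsVec ψ : FreeProd A → ψ.GNS) = fun x => ψ.gnsStarAlgHom x (gnsVec ψ 1) :=
    funext fun x => by rw [gnsStarAlgHom_gnsVec, mul_one]
  rw [this]
  have hc := StarAlgHom.continuous_of_cstar ψ.gnsStarAlgHom
  fun_prop

/-- A closed set of vectors that contains the classes of all words is everything. -/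
lemma mem_of_isClosed_of_gnsVec {s : Set ψ.GNS} (hs : IsClosed s)
    (h : ∀ M, ∀ x ∈ FreeProd.upTo A M, gnsVec ψ x ∈ s) (v : ψ.GNS) : v ∈ s := by
  refine (denseRange_gnsVec ψ).induction_on v hs fun x => ?_
  exact FreeProd.mem_of_isClosed (hs.preimage continuous_gnsVec) h x

/-- Operators with the same matrix coefficients at words are equal. -/
lemma ext_inner_gnsVec {S T : GNSOp ψ} (h : ∀ M, ∀ x ∈ FreeProd.upTo A M,
    ∀ y ∈ FreeProd.upTo A M, ⟪gnsVec ψ x, S (gnsVec ψ y)⟫_ℂ = ⟪gnsVec ψ x, T (gnsVec ψ y)⟫_ℂ) :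
    S = T := by
  refine ContinuousLinearMap.ext fun w => ?_
  refine mem_of_isClosed_of_gnsVec (s := {w | S w = T w})
    (isClosed_eq S.continuous T.continuous) (fun N y hy => ?_) w
  refine ext_inner_left ℂ fun v => ?_
  refine mem_of_isClosed_of_gnsVec
    (s := {v | ⟪v, S (gnsVec ψ y)⟫_ℂ = ⟪v, T (gnsVec ψ y)⟫_ℂ})
    (isClosed_eq (by fun_prop) (by fun_prop)) (fun M x hx => ?_) v
  exact h (max M N) x (FreeProd.upTo_mono (le_max_left _ _) hx) y
    (FreeProd.upTo_mono (le_max_right _ _) hy)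

namespace IsTailShift

variable {α : tailExtension ψ →⋆ₐ[ℂ] tailExtension ψ} (hα : IsTailShift ψ α)

include hα

/-- On words, the matrix coefficients of the orbits of the shift are eventually constant. -/
lemma inner_iterate_eq (hψ : IsPermInvariant ψ) {K M n : ℕ} (hn : K ≤ n) {x : tailExtension ψ}
    (hx : (x : GNSOp ψ) ∈ partialExtension ψ M) {y z : FreeProd A}
    (hy : y ∈ FreeProd.upTo A K) (hz : z ∈ FreeProd.upTo A K) :
    ⟪gnsVec ψ y, (α^[n] x : GNSOp ψ) (gnsVec ψ z)⟫_ℂ =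
      ⟪gnsVec ψ y, (α^[K] x : GNSOp ψ) (gnsVec ψ z)⟫_ℂ := by
  obtain ⟨σ, hσ, hσ'⟩ := Equiv.Perm.exists_isFinitary_extending (· + K) (Finset.range M)
    (add_left_injective K).injOn
  -- `τ` fixes the indices occurring in `y` and `z` and carries the block K, …, K + M - 1 onto n, …,
  -- n + M - 1, so `τ * σ` shifts the first `M` indices by `n`. Injectivity needs `K ≤ n`.
  obtain ⟨τ, hτ, hτ'⟩ := Equiv.Perm.exists_isFinitary_extending
    (fun i => if i < K then i else i - K + n) (Finset.range (K + M)) (fun i _ j _ h => by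
      simp only at h
      split_ifs at h <;> omega)
  have h1 : ∀ i < K, τ i = i := fun i hi => by
    rw [hτ' i (Finset.mem_range.2 (by omega)), if_pos hi]
  have h2 : ∀ i < M, (τ * σ) i = i + n := fun i hi => by
    rw [Equiv.Perm.mul_apply, hσ' i (Finset.mem_range.2 hi),
      hτ' _ (Finset.mem_range.2 (by omega)), if_neg (by omega)]
    omega
  rw [hα.iterate_eq_gnsConj hψ (hτ.mul hσ) h2 hx, ← gnsConj_gnsConj,
    inner_gnsConj hψ h1 hy hz,
    hα.iterate_eq_gnsConj hψ hσ (fun i hi => hσ' i (Finset.mem_range.2 hi)) hx]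

/-- Contractivity of the iterates makes the Cauchy condition closed in `x`, `w` and `v` separately.
It thus suffices to treat partial extensions and vectors from finitely many factors, where the
coefficients are eventually constant. -/
lemma cauchySeq_inner_iterate (hψ : IsPermInvariant ψ) (x : tailExtension ψ) (v w : ψ.GNS) :
    CauchySeq fun n => ⟪(α^[n] x : GNSOp ψ) w, v⟫_ℂ := by
  have hlip : ∀ {E : Type (u + 1)} [SeminormedAddCommGroup E] (g : ℕ → E → ℂ) (C : ℝ)
      (_ : 0 ≤ C), (∀ n a b, g n a - g n b = g n (a - b)) → (∀ n a, ‖g n a‖ ≤ C * ‖a‖) →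
      IsClosed {a | CauchySeq fun n => g n a} := fun g C hC h1 h2 =>
    isClosed_setOf_cauchySeq (C := ⟨C, hC⟩) fun n => LipschitzWith.of_dist_le_mul fun a b => by
      rw [dist_eq_norm, dist_eq_norm, h1]
      exact h2 n _
  have hbound : ∀ n (x : tailExtension ψ) v w,
      ‖⟪(α^[n] x : GNSOp ψ) w, v⟫_ℂ‖ ≤ ‖x‖ * ‖w‖ * ‖v‖ := fun n x v w =>
    (norm_inner_le_norm _ _).trans (by
      gcongr
      exact ContinuousLinearMap.le_of_opNorm_le _ (norm_iterate_le α n x) w)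
  refine mem_of_isClosed_of_partialExtension ψ
    (s := {x | CauchySeq fun n => ⟪(α^[n] x : GNSOp ψ) w, v⟫_ℂ})
    (hlip _ (‖w‖ * ‖v‖) (by positivity) (fun n a b => ?_)
      fun n a => (hbound n a v w).trans_eq (by ring)) (fun M x hx => ?_) x
  · obtain ⟨β, hβ⟩ := StarAlgHom.exists_iterate α n
    simp only [← hβ, map_sub, ← inner_sub_left]
    rfl
  refine mem_of_isClosed_of_gnsVec (s := {w | CauchySeq fun n => ⟪(α^[n] x : GNSOp ψ) w, v⟫_ℂ})
    (hlip _ (‖x‖ * ‖v‖) (by positivity) (fun n a b => by rw [← inner_sub_left, map_sub])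
      fun n a => (hbound n x v a).trans_eq (by ring)) (fun N y hy => ?_) w
  refine mem_of_isClosed_of_gnsVec
    (s := {v | CauchySeq fun n => ⟪(α^[n] x : GNSOp ψ) (gnsVec ψ y), v⟫_ℂ})
    (hlip _ (‖x‖ * ‖gnsVec ψ y‖) (by positivity) (fun n a b => by rw [← inner_sub_right])
      fun n a => hbound n x a _) (fun N' z hz => ?_) v
  refine (tendsto_atTop_of_eventually_const (i₀ := max N N')
    (x := ⟪(α^[max N N'] x : GNSOp ψ) (gnsVec ψ y), gnsVec ψ z⟫_ℂ) fun n hn => ?_).cauchySeq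
  rw [← inner_conj_symm, hα.inner_iterate_eq hψ hn hx
      (FreeProd.upTo_mono (le_max_right _ _) hz) (FreeProd.upTo_mono (le_max_left _ _) hy),
    inner_conj_symm]

omit hα in
lemma gnsStarAlgHom_mem_generatedVN {N : ℕ} {f : ℕ → ℕ} (hf : ∀ i, N ≤ f i) (x : FreeProd A) :
    ψ.gnsStarAlgHom (FreeProd.reindex f x) ∈
      generatedVN (⋃ i ≥ N, Set.range (gnsFactor ψ i)) := by
  refine FreeProd.mem_of_isClosed ((isClosed_centralizer_starSubalgebra _).preimage
    (StarAlgHom.continuous_of_cstar (ψ.gnsStarAlgHom.comp (FreeProd.reindex f))))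
    (fun M y hy => ?_) x
  have h : FreeProd.upTo A M ≤ (generatedVN (⋃ i ≥ N, Set.range (gnsFactor ψ i))).comap
      (ψ.gnsStarAlgHom.comp (FreeProd.reindex f)) := by
    refine StarAlgebra.adjoin_le fun z hz => ?_
    obtain ⟨i, -, a, rfl⟩ := Set.mem_iUnion₂.1 hz
    exact StarAlgebra.adjoin_le_centralizer_centralizer ℂ _
      (StarAlgebra.subset_adjoin ℂ _ (Set.mem_iUnion₂.2 ⟨f i, hf i, a, rfl⟩))
  exact h hy

/-- The n-th iterate moves every factor to an index at least n ≥ N and fixes the tail, which lies in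
all these von Neumann algebras. -/
lemma iterate_mem_generatedVN {n N : ℕ} (hn : N ≤ n) (x : tailExtension ψ) :
    (α^[n] x : GNSOp ψ) ∈ generatedVN (⋃ i ≥ N, Set.range (gnsFactor ψ i)) := by
  obtain ⟨β, hβ⟩ := StarAlgHom.exists_iterate α n
  have hc : Continuous fun x => (β x : GNSOp ψ) :=
    StarAlgHom.continuous_of_cstar ((tailExtension ψ).subtype.comp β)
  rw [← hβ]
  refine mem_of_isClosed_of_partialExtension ψ
    ((isClosed_centralizer_starSubalgebra _).preimage hc) (fun M y hy => ?_) x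
  have hle : partialExtension ψ M ≤ ((generatedVN (⋃ i ≥ N, Set.range (gnsFactor ψ i))).comap
      ((tailExtension ψ).subtype.comp β)).map (tailExtension ψ).subtype := by
    refine StarAlgebra.adjoin_le fun y hy => ?_
    rcases hy with ⟨z, hz, rfl⟩ | hy
    · have h : (β (gnsToExtension ψ z) : GNSOp ψ) ∈
          generatedVN (⋃ i ≥ N, Set.range (gnsFactor ψ i)) := by
        rw [hβ, hα.iterate_gnsToExtension]
        exact gnsStarAlgHom_mem_generatedVN (fun i => by omega) z
      exact ⟨gnsToExtension ψ z, h, rfl⟩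
    · have h : (β ⟨y, tailAlgebra_le_tailExtension ψ hy⟩ : GNSOp ψ) ∈
          generatedVN (⋃ i ≥ N, Set.range (gnsFactor ψ i)) := by
        rw [hβ, hα.iterate_of_mem_tailAlgebra n hy]
        exact StarSubalgebra.mem_iInf.1 hy N
      exact ⟨⟨y, tailAlgebra_le_tailExtension ψ hy⟩, h, rfl⟩
  obtain ⟨z, hz, hzy⟩ := hle hy
  obtain rfl : z = y := Subtype.ext hzy
  exact hz

/-- A weak limit of an orbit of the shift lies in the tail algebra. -/
lemma weak_limit_mem_tailAlgebra {x : tailExtension ψ} {L : GNSOp ψ}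
    (hL : ∀ v w, Filter.Tendsto (fun n => ⟪v, (α^[n] x : GNSOp ψ) w⟫_ℂ) Filter.atTop
      (𝓝 ⟪v, L w⟫_ℂ)) : L ∈ tailAlgebra ψ := by
  refine StarSubalgebra.mem_iInf.2 fun N => ?_
  have key : ∀ g ∈ StarSubalgebra.centralizer ℂ (⋃ i ≥ N, Set.range (gnsFactor ψ i)),
      g * L = L * g := fun g hg => by
    refine ContinuousLinearMap.ext fun w => ext_inner_left ℂ fun v => ?_
    rw [mul_apply_eq_comp, mul_apply_eq_comp, ← ContinuousLinearMap.adjoint_inner_left]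
    refine tendsto_nhds_unique (hL (ContinuousLinearMap.adjoint g v) w) ?_
    refine (hL v (g w)).congr' (Filter.eventually_atTop.2 ⟨N, fun n hn => ?_⟩)
    have h := ((StarSubalgebra.mem_centralizer_iff ℂ).1 (hα.iterate_mem_generatedVN hn x) g hg).1
    simp only [ContinuousLinearMap.adjoint_inner_left]
    rw [← mul_apply_eq_comp, ← mul_apply_eq_comp, h]
  rw [generatedVN, StarSubalgebra.mem_centralizer_iff]
  exact fun g hg => ⟨key g hg, key _ (star_mem hg)⟩

end IsTailShift

section TailExpectation

lemma exists_tendsto_shiftOrbit (hψ : IsPermInvariant ψ) (x : tailExtension ψ) :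
    ∃ L, Filter.Tendsto (shiftOrbit ψ x) Filter.atTop (𝓝 L) := by
  have hα := isTailShift_tailShift hψ
  obtain ⟨L, hL⟩ := exists_weak_limit (fun n => ((tailShift ψ)^[n] x : GNSOp ψ)) ‖x‖
    (fun n => norm_iterate_le _ n x) (hα.cauchySeq_inner_iterate hψ x)
  refine ⟨.ofCLM L, ?_⟩
  rw [ContinuousLinearMapWOT.tendsto_iff_forall_dual_apply_tendsto]
  intro w f
  have := hL ((InnerProductSpace.toDual ℂ _).symm f) w
  simp only [InnerProductSpace.toDual_symm_apply] at this
  exact this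

lemma tendsto_shiftOrbit (hψ : IsPermInvariant ψ) (x : tailExtension ψ) :
    Filter.Tendsto (shiftOrbit ψ x) Filter.atTop (𝓝 (.ofCLM (tailExpectation ψ x))) :=
  tendsto_nhds_limUnder (exists_tendsto_shiftOrbit hψ x)

lemma tendsto_inner_tailExpectation (hψ : IsPermInvariant ψ) (x : tailExtension ψ)
    (v w : ψ.GNS) :
    Filter.Tendsto (fun n => ⟪v, ((tailShift ψ)^[n] x : GNSOp ψ) w⟫_ℂ) Filter.atTop
      (𝓝 ⟪v, tailExpectation ψ x w⟫_ℂ) :=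
  ContinuousLinearMapWOT.tendsto_iff_forall_dual_apply_tendsto.1 (tendsto_shiftOrbit hψ x) w
    (InnerProductSpace.toDual ℂ _ v)

lemma tailExpectation_mem_tailAlgebra (hψ : IsPermInvariant ψ) (x : tailExtension ψ) :
    tailExpectation ψ x ∈ tailAlgebra ψ :=
  (isTailShift_tailShift hψ).weak_limit_mem_tailAlgebra (tendsto_inner_tailExpectation hψ x)

end TailExpectation

end Expectation
end

noncomputable section

variable {A : Type u} [CStarAlgebra A]

section StateDecomposition

variable {ψ : FreeProd A →ₚ[ℂ] ℂ}

/-! ### Properties of the conditional expectation -/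

lemma complex_inner_self_nonneg {H : Type*} [NormedAddCommGroup H] [InnerProductSpace ℂ H]
    (v : H) : 0 ≤ ⟪v, v⟫_ℂ := by
  rw [inner_self_eq_norm_sq_to_K]
  rw [← RCLike.ofReal_pow]
  exact RCLike.ofReal_nonneg.2 (sq_nonneg ‖v‖)

lemma tailExpectation_eq (hψ : IsPermInvariant ψ) {x : tailExtension ψ} {L : GNSOp ψ}
    (h : ∀ v w, Filter.Tendsto (fun n => ⟪v, ((tailShift ψ)^[n] x : GNSOp ψ) w⟫_ℂ) Filter.atTop
      (𝓝 ⟪v, L w⟫_ℂ)) : tailExpectation ψ x = L :=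
  ContinuousLinearMap.ext fun w => ext_inner_left ℂ fun v =>
    tendsto_nhds_unique (tendsto_inner_tailExpectation hψ x v w) (h v w)

/-- The conditional expectation as a linear map. -/
def tailExpectationLM (hψ : IsPermInvariant ψ) : tailExtension ψ →ₗ[ℂ] GNSOp ψ where
  toFun := tailExpectation ψ
  map_add' x y := tailExpectation_eq hψ fun v w => by
    have := (tendsto_inner_tailExpectation hψ x v w).add (tendsto_inner_tailExpectation hψ y v w)
    simpa [iterate_map_add, inner_add_right] using this
  map_smul' c x := tailExpectation_eq hψ fun v w => by
    have := (tendsto_inner_tailExpectation hψ x v w).const_mul c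
    have hc : ∀ n, (tailShift ψ)^[n] (c • x) = c • (tailShift ψ)^[n] x := fun n => by
      obtain ⟨β, hβ⟩ := StarAlgHom.exists_iterate (tailShift ψ) n
      rw [← hβ, ← hβ, map_smul]
    simpa [hc, inner_smul_right] using this

/-- The iterates are contractive, and the operator norm is bounded by real parts of matrix
coefficients, which pass to the weak limit. -/
lemma norm_tailExpectation_le (hψ : IsPermInvariant ψ) (x : tailExtension ψ) :
    ‖tailExpectation ψ x‖ ≤ ‖x‖ := by
  refine ContinuousLinearMap.opNorm_le_of_re_inner_le (norm_nonneg _) fun v w hv hw => ?_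
  have h := (Complex.continuous_re.tendsto _).comp (tendsto_inner_tailExpectation hψ x w v)
  rw [inner_re_symm]
  refine le_of_tendsto h (Filter.Eventually.of_forall fun n => ?_)
  refine (Complex.re_le_norm _).trans ((norm_inner_le_norm _ _).trans ?_)
  have := ContinuousLinearMap.le_of_opNorm_le _ (norm_iterate_le (tailShift ψ) n x) v
  rw [hv, mul_one] at this
  rwa [hw, one_mul]

lemma continuous_tailExpectation_gnsToExtension (hψ : IsPermInvariant ψ) :
    Continuous fun x => tailExpectation ψ (gnsToExtension ψ x) := by
  have h : Continuous (tailExpectationLM hψ) :=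
    AddMonoidHomClass.continuous_of_bound (tailExpectationLM hψ) 1 fun x => by
      rw [one_mul]
      exact norm_tailExpectation_le hψ x
  exact h.comp (StarAlgHom.continuous_of_cstar (gnsToExtension ψ))

lemma tailExpectation_of_mem_tailAlgebra (hψ : IsPermInvariant ψ) {x : tailExtension ψ}
    (hx : (x : GNSOp ψ) ∈ tailAlgebra ψ) : tailExpectation ψ x = x :=
  tailExpectation_eq hψ fun v w => by
    simp only [(isTailShift_tailShift hψ).iterate_of_mem_tailAlgebra _ hx]
    exact tendsto_const_nhds

lemma tailExpectation_nonneg (hψ : IsPermInvariant ψ) (x : tailExtension ψ) :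
    0 ≤ tailExpectation ψ (star x * x) := by
  rw [ContinuousLinearMap.nonneg_iff_isPositive, ContinuousLinearMap.isPositive_iff_complex]
  intro v
  have h : 0 ≤ ⟪v, tailExpectation ψ (star x * x) v⟫_ℂ := by
    refine ge_of_tendsto (tendsto_inner_tailExpectation hψ _ v v)
      (Filter.Eventually.of_forall fun n => ?_)
    obtain ⟨β, hβ⟩ := StarAlgHom.exists_iterate (tailShift ψ) n
    rw [← hβ, map_mul, map_star]
    change 0 ≤ ⟪v, (star (β x : GNSOp ψ) * (β x : GNSOp ψ)) v⟫_ℂ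
    rw [mul_apply_eq_comp, ContinuousLinearMap.star_eq_adjoint,
      ContinuousLinearMap.adjoint_inner_right]
    exact complex_inner_self_nonneg _
  rw [← inner_conj_symm, (Complex.conj_eq_iff_real.2 ?_ : (starRingEnd ℂ) _ = _)]
  · exact ⟨Complex.ext rfl (by simpa using (Complex.le_def.1 h).2), (Complex.le_def.1 h).1⟩
  · exact ⟨_, Complex.ext rfl (by simpa using (Complex.le_def.1 h).2.symm)⟩

/-- A permutation invariant functional is invariant under injections of the index set. -/
lemma IsPermInvariant.apply_reindex (hψ : IsPermInvariant ψ) {f : ℕ → ℕ}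
    (hf : Function.Injective f) (x : FreeProd A) : ψ (FreeProd.reindex f x) = ψ x := by
  have hc := (continuous_of_nonneg ψ).comp (StarAlgHom.continuous_of_cstar (FreeProd.reindex f))
  refine FreeProd.mem_of_isClosed (s := {x | ψ (FreeProd.reindex f x) = ψ x})
    (isClosed_eq hc (continuous_of_nonneg ψ)) (fun M y hy => ?_) x
  obtain ⟨σ, -, hσ⟩ := Equiv.Perm.exists_isFinitary_extending f (Finset.range M) hf.injOn
  change ψ (FreeProd.reindex f y) = ψ y
  rw [FreeProd.reindex_eq_of_mem_upTo (g := σ)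
    (fun i hi => (hσ i (Finset.mem_range.2 hi)).symm) hy, hψ]

/-- The conditional expectation does not see permutations of the free factors. -/
lemma tailExpectation_reindex (hψ : IsPermInvariant ψ) (ρ : Equiv.Perm ℕ) (x : FreeProd A) :
    tailExpectation ψ (gnsToExtension ψ (FreeProd.reindex ρ x)) =
      tailExpectation ψ (gnsToExtension ψ x) := by
  have hα := isTailShift_tailShift hψ
  have hc := continuous_tailExpectation_gnsToExtension hψ
  refine FreeProd.mem_of_isClosed (s := {x | tailExpectation ψ (gnsToExtension ψ
    (FreeProd.reindex ρ x)) = tailExpectation ψ (gnsToExtension ψ x)})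
    (isClosed_eq (hc.comp (StarAlgHom.continuous_of_cstar (FreeProd.reindex ρ))) hc)
    (fun M x hx => ?_) x
  refine ext_inner_gnsVec fun K y hy z hz => ?_
  refine tendsto_nhds_unique (tendsto_inner_tailExpectation hψ _ _ _) ?_
  refine (tendsto_inner_tailExpectation hψ _ _ _).congr'
    (Filter.eventually_atTop.2 ⟨K, fun n hn => ?_⟩)
  -- `τ` is `ρ` transported to the indices from `n` on: applying `ρ` and then shifting equals
  -- shifting and then applying `τ`. Since `τ` fixes the indices below `K ≤ n`, the coefficients do
  -- not change.
  obtain ⟨τ, -, hτ⟩ := Equiv.Perm.exists_isFinitary_extending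
    (fun i => if i < n then i else ρ (i - n) + n) (Finset.range (n + M)) (fun i _ j _ h => by
      simp only at h
      split_ifs at h
      · exact h
      · omega
      · omega
      · have := ρ.injective (Nat.add_right_cancel h)
        omega)
  have h1 : ∀ i < K, τ i = i := fun i hi => by
    rw [hτ i (Finset.mem_range.2 (by omega)), if_pos (by omega)]
  have h2 : FreeProd.reindex (· + n) (FreeProd.reindex ρ x) =
      FreeProd.reindex τ (FreeProd.reindex (· + n) x) := by
    rw [FreeProd.reindex_reindex, FreeProd.reindex_reindex]
    refine FreeProd.reindex_eq_of_mem_upTo (fun i hi => ?_) hx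
    rw [Function.comp_apply, Function.comp_apply, hτ _ (Finset.mem_range.2 (by omega)),
      if_neg (by omega), Nat.add_sub_cancel]
  simp only [hα.iterate_gnsToExtension]
  rw [h2, coe_gnsToExtension,
    coe_gnsToExtension, ← gnsConj_gnsStarAlgHom hψ, inner_gnsConj hψ h1 hy hz]

/-! ### The tail C⋆-algebra -/

lemma tailCStar_le_tailAlgebra (hψ : IsPermInvariant ψ) : tailCStar ψ ≤ tailAlgebra ψ := by
  refine sInf_le ⟨le_rfl, ?_, fun _ _ _ z _ => tailExpectation_mem_tailAlgebra hψ z⟩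
  rw [tailAlgebra, StarSubalgebra.coe_iInf]
  exact isClosed_iInter fun N => isClosed_centralizer_starSubalgebra _

variable (ψ) in
lemma isClosed_tailCStar : IsClosed (tailCStar ψ : Set (GNSOp ψ)) := by
  rw [tailCStar, StarSubalgebra.coe_sInf]
  exact isClosed_biInter fun S hS => hS.2.1

/-- Words in the factors are the alternating words whose tail entries are all 1; linearity and norm
continuity of the expectation give the rest. The empty word is read as the unit of factor 0, since
alternating words have at least one letter. -/
lemma tailExpectation_mem_tailCStar (hψ : IsPermInvariant ψ) (x : FreeProd A) :
    tailExpectation ψ (gnsToExtension ψ x) ∈ tailCStar ψ := by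
  refine StarSubalgebra.mem_sInf.2 fun S hS => ?_
  let V : Submodule ℂ (FreeProd A) := (Subalgebra.toSubmodule S.toSubalgebra).comap
    ((tailExpectationLM hψ) ∘ₗ (gnsToExtension ψ).toAlgHom.toLinearMap)
  have hV : IsClosed (V : Set (FreeProd A)) :=
    hS.2.1.preimage (continuous_tailExpectation_gnsToExtension hψ)
  refine FreeProd.mem_of_word_mem hV (fun w => ?_) x
  have key : ∀ (i : ℕ) (a : A) (w : List (ℕ × A)),
      tailExpectation ψ (gnsToExtension ψ (FreeProd.word ((i, a) :: w))) ∈ S := fun i a w => by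
    refine hS.2.2 i a (w.map fun p => (1, p.1, p.2)) _ ?_
    rw [coe_gnsToExtension, FreeProd.word, List.map_cons, List.prod_cons, map_mul, map_list_prod,
      List.map_map, List.map_map]
    congr 3
  rcases w with _ | ⟨⟨i, a⟩, w⟩
  · have : FreeProd.word ([] : List (ℕ × A)) = FreeProd.word [(0, 1)] := by simp [FreeProd.word]
    rw [this]
    exact key 0 1 []
  · exact key i a w

/-- Shifting is reindexing by an injection, so the vacuum coefficients along the orbit all equal `ψ
x`. -/
lemma apply_eq_tailRestriction (hψ : IsPermInvariant ψ) (x : FreeProd A) :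
    ψ x = tailRestriction ψ ⟨_, tailExpectation_mem_tailCStar hψ x⟩ := by
  have h := tendsto_inner_tailExpectation hψ (gnsToExtension ψ x) (gnsVacuum ψ) (gnsVacuum ψ)
  refine tendsto_nhds_unique (tendsto_const_nhds.congr fun n => ?_) h
  rw [(isTailShift_tailShift hψ).iterate_gnsToExtension, coe_gnsToExtension]
  exact ((vacuumState_gnsStarAlgHom _).trans
    (hψ.apply_reindex (add_left_injective n) x)).symm

lemma tailRestriction_mem_stateSpace (h1 : ψ 1 = 1) :
    tailRestriction ψ ∈ stateSpace (tailCStar ψ) := by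
  refine ⟨?_, fun d => ?_⟩
  · have := vacuumState_gnsStarAlgHom (ψ := ψ) 1
    rw [map_one, h1] at this
    exact this
  · change 0 ≤ ⟪gnsVacuum ψ, (star (d : GNSOp ψ) * (d : GNSOp ψ)) (gnsVacuum ψ)⟫_ℂ
    rw [mul_apply_eq_comp, ContinuousLinearMap.star_eq_adjoint,
      ContinuousLinearMap.adjoint_inner_right]
    exact complex_inner_self_nonneg _

/-- Operators commuting with the representation commute with the tail algebra. -/
lemma commute_of_mem_tailAlgebra {h : GNSOp ψ}
    (hh : ∀ x, ψ.gnsStarAlgHom x * h = h * ψ.gnsStarAlgHom x) {T : GNSOp ψ}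
    (hT : T ∈ tailAlgebra ψ) : h * T = T * h := by
  -- At `N = 0` the von Neumann algebra is generated by all the factors.
  have h0 := StarSubalgebra.mem_iInf.1 hT 0
  rw [generatedVN, StarSubalgebra.mem_centralizer_iff] at h0
  refine (h0 h ?_).1
  rw [SetLike.mem_coe, StarSubalgebra.mem_centralizer_iff]
  intro g hg
  obtain ⟨i, -, a, rfl⟩ := Set.mem_iUnion₂.1 hg
  exact ⟨hh _, by rw [← map_star]; exact hh (FreeProd.incl A i (star a))⟩

/-! ### Functionals dominated by `ψ` and their counterparts on the tail C⋆-algebra -/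

section Dominated

variable {φ : FreeProd A →ₚ[ℂ] ℂ} {C : ℝ}
  (hφ : ∀ x, φ (star x * x) ≤ C * ψ (star x * x))

/-- The canonical map between the GNS spaces of a functional and of a functional dominated by it. -/
def gnsDominated : ψ.GNS →L[ℂ] φ.GNS := gnsMap ψ φ LinearMap.id C hφ

@[simp]
lemma gnsDominated_gnsVec (x : FreeProd A) : gnsDominated hφ (gnsVec ψ x) = gnsVec φ x :=
  gnsMap_gnsVec _ _ _ _ _ _

/-- The functional on the tail C⋆-algebra corresponding to a dominated functional. -/
def dominatedRestriction : tailCStar ψ →ₗ[ℂ] ℂ where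
  toFun d := ⟪gnsVacuum φ, gnsDominated hφ ((d : GNSOp ψ) (gnsVacuum ψ))⟫_ℂ
  map_add' c d := by simp [inner_add_right]
  map_smul' c d := by simp [inner_smul_right]

lemma gnsDominated_gnsStarAlgHom (x : FreeProd A) (v : ψ.GNS) :
    gnsDominated hφ (ψ.gnsStarAlgHom x v) = φ.gnsStarAlgHom x (gnsDominated hφ v) := by
  have : (gnsDominated hφ).comp (ψ.gnsStarAlgHom x) =
      (φ.gnsStarAlgHom x).comp (gnsDominated hφ) :=
    ext_gnsVec fun y => by
      simp only [ContinuousLinearMap.comp_apply, gnsStarAlgHom_gnsVec, gnsDominated_gnsVec]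
  exact DFunLike.congr_fun this v

/-- Positivity: J*J is in the commutant of π(𝔄), hence commutes with d*, and ⟨1̂, J*J d*d 1̂⟩ = ‖J d
1̂‖². -/
lemma dominatedRestriction_mem_stateSpace (hψ : IsPermInvariant ψ) (h1 : φ 1 = 1) :
    dominatedRestriction hφ ∈ stateSpace (tailCStar ψ) := by
  set J := gnsDominated hφ with hJ
  have hvac : gnsVacuum φ = J (gnsVacuum ψ) := by
    rw [← gnsVec_one, ← gnsVec_one, hJ, gnsDominated_gnsVec]
  refine ⟨?_, fun d => ?_⟩
  · change ⟪gnsVacuum φ, J (gnsVacuum ψ)⟫_ℂ = 1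
    rw [← hvac, ← gnsVec_one, inner_gnsVec, star_one, one_mul, h1]
  · have hcomm : ∀ x, ψ.gnsStarAlgHom x * (ContinuousLinearMap.adjoint J ∘L J) =
        (ContinuousLinearMap.adjoint J ∘L J) * ψ.gnsStarAlgHom x := fun x => by
      refine ContinuousLinearMap.ext fun w => ext_inner_left ℂ fun v => ?_
      have hadj : ψ.gnsStarAlgHom x =
          ContinuousLinearMap.adjoint (ψ.gnsStarAlgHom (star x)) := by
        rw [← ContinuousLinearMap.star_eq_adjoint, ← map_star, star_star]
      have hadj' : φ.gnsStarAlgHom x =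
          ContinuousLinearMap.adjoint (φ.gnsStarAlgHom (star x)) := by
        rw [← ContinuousLinearMap.star_eq_adjoint, ← map_star, star_star]
      simp only [mul_apply_eq_comp, ContinuousLinearMap.comp_apply,
        ContinuousLinearMap.adjoint_inner_right]
      rw [hJ, gnsDominated_gnsStarAlgHom, hadj', ContinuousLinearMap.adjoint_inner_right,
        ← gnsDominated_gnsStarAlgHom, hadj, ContinuousLinearMap.adjoint_inner_right,
        ContinuousLinearMap.adjoint_inner_right]
    have hd := commute_of_mem_tailAlgebra hcomm (star_mem (tailCStar_le_tailAlgebra hψ d.2))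
    change 0 ≤ ⟪gnsVacuum φ, J ((star (d : GNSOp ψ) * (d : GNSOp ψ)) (gnsVacuum ψ))⟫_ℂ
    have h2 := DFunLike.congr_fun hd ((d : GNSOp ψ) (gnsVacuum ψ))
    rw [hvac, ← ContinuousLinearMap.adjoint_inner_right, mul_apply_eq_comp]
    rw [mul_apply_eq_comp, mul_apply_eq_comp] at h2
    change 0 ≤ ⟪gnsVacuum ψ, (ContinuousLinearMap.adjoint J ∘L J)
      ((star (d : GNSOp ψ)) ((d : GNSOp ψ) (gnsVacuum ψ)))⟫_ℂ
    rw [h2, ContinuousLinearMap.star_eq_adjoint, ContinuousLinearMap.adjoint_inner_right,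
      ContinuousLinearMap.comp_apply, ContinuousLinearMap.adjoint_inner_right]
    exact complex_inner_self_nonneg _

/-- The orbit of the shift for `ψ` is tested against the vectors J*1̂ and 1̂; each coefficient is
the value of `φ` at a shifted element, hence `φ x`. -/
lemma apply_eq_dominatedRestriction (hψ : IsPermInvariant ψ) (hφi : IsPermInvariant φ)
    (x : FreeProd A) :
    φ x = dominatedRestriction hφ ⟨_, tailExpectation_mem_tailCStar hψ x⟩ := by
  have h := tendsto_inner_tailExpectation hψ (gnsToExtension ψ x)
    (ContinuousLinearMap.adjoint (gnsDominated hφ) (gnsVacuum φ)) (gnsVacuum ψ)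
  simp only [ContinuousLinearMap.adjoint_inner_left] at h
  refine tendsto_nhds_unique (tendsto_const_nhds.congr fun n => ?_) h
  rw [(isTailShift_tailShift hψ).iterate_gnsToExtension, coe_gnsToExtension,
    ← gnsVec_one, ← gnsVec_one, gnsStarAlgHom_gnsVec, gnsDominated_gnsVec, inner_gnsVec, star_one,
    one_mul, mul_one, hφi.apply_reindex (add_left_injective n)]

end Dominated

end StateDecomposition
end

/-! ### Purity on the tail C⋆-algebra and extremality among symmetric states -/

noncomputable section

/-- Positive operators in a closed `*`-subalgebra have a square root there. -/
lemma StarSubalgebra.exists_star_mul_self {H : Type*} [NormedAddCommGroup H]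
    [InnerProductSpace ℂ H] [CompleteSpace H] (S : StarSubalgebra ℂ (H →L[ℂ] H))
    (hS : IsClosed (S : Set (H →L[ℂ] H))) {T : H →L[ℂ] H} (hT : T ∈ S) (h0 : 0 ≤ T) :
    ∃ R : S, T = (R : H →L[ℂ] H) * R ∧ star R = R := by
  have hmem : CFC.sqrt T ∈ S := by
    rw [CFC.sqrt_eq_real_sqrt T h0]
    exact cfcₙ_mem (𝕜' := ℂ) (hs := hS) _ hT
  refine ⟨⟨CFC.sqrt T, hmem⟩, (CFC.sqrt_mul_sqrt_self T h0).symm, Subtype.ext ?_⟩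
  exact (CFC.sqrt_nonneg T).isSelfAdjoint.star_eq

variable {A : Type u} [CStarAlgebra A] {ψ : FreeProd A →ₚ[ℂ] ℂ}

/-- A state of a unital C⋆-algebra as a positive linear map. -/
def positiveOfState {φ : FreeProd A →ₗ[ℂ] ℂ} (hφ : φ ∈ stateSpace (FreeProd A)) :
    FreeProd A →ₚ[ℂ] ℂ :=
  PositiveLinearMap.mk₀ φ fun x hx => by
    obtain ⟨y, rfl⟩ := CStarAlgebra.nonneg_iff_eq_star_mul_self.1 hx
    exact hφ.2 y

lemma positiveOfState_apply {φ : FreeProd A →ₗ[ℂ] ℂ} (hφ : φ ∈ stateSpace (FreeProd A))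
    (x : FreeProd A) : positiveOfState hφ x = φ x := rfl

/-- If the restriction of the vector state to the tail C⋆-algebra is pure, then the symmetric state
is extreme. -/
lemma mem_extremePoints_of_isPureState (hψ : ψ.toLinearMap ∈ symmetricStates A)
    (hρ : IsPureState (tailRestriction ψ)) :
    ψ.toLinearMap ∈ Set.extremePoints ℝ (symmetricStates A) := by
  have hinv := isPermInvariant_of_mem_symmetricStates hψ
  refine ⟨hψ, fun φ₁ h₁ φ₂ h₂ hseg => ?_⟩
  obtain ⟨a, b, ha, hb, hab, heq⟩ := hseg
  have heq' : ∀ x, (a : ℂ) * φ₁ x + b * φ₂ x = ψ x := fun x => by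
    simpa using LinearMap.congr_fun heq x
  -- `a φ₁ ≤ ψ` on positive elements because `b φ₂ ≥ 0` there, whence the constant `a⁻¹`.
  have hdom₁ : ∀ x, positiveOfState h₁.1 (star x * x) ≤ ((a⁻¹ : ℝ) : ℂ) * ψ (star x * x) := by
    intro x
    have h := heq' (star x * x)
    have hpos : 0 ≤ (b : ℂ) * φ₂ (star x * x) :=
      mul_nonneg (Complex.zero_le_real.2 hb.le) (h₂.1.2 x)
    have ha' : (a : ℂ) ≠ 0 := Complex.ofReal_ne_zero.2 ha.ne'
    rw [← h, mul_add, ← mul_assoc, Complex.ofReal_inv, inv_mul_cancel₀ ha', one_mul,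
      positiveOfState_apply]
    refine le_add_of_nonneg_right (mul_nonneg ?_ hpos)
    rw [← Complex.ofReal_inv]
    exact Complex.zero_le_real.2 (inv_nonneg.2 ha.le)
  have hdom₂ : ∀ x, positiveOfState h₂.1 (star x * x) ≤ ((b⁻¹ : ℝ) : ℂ) * ψ (star x * x) := by
    intro x
    have h := heq' (star x * x)
    have hpos : 0 ≤ (a : ℂ) * φ₁ (star x * x) :=
      mul_nonneg (Complex.zero_le_real.2 ha.le) (h₁.1.2 x)
    have hb' : (b : ℂ) ≠ 0 := Complex.ofReal_ne_zero.2 hb.ne'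
    rw [← h, mul_add, ← mul_assoc _ (b : ℂ), Complex.ofReal_inv, inv_mul_cancel₀ hb', one_mul,
      positiveOfState_apply]
    refine le_add_of_nonneg_left (mul_nonneg ?_ hpos)
    rw [← Complex.ofReal_inv]
    exact Complex.zero_le_real.2 (inv_nonneg.2 hb.le)
  have hi₁ : IsPermInvariant (positiveOfState h₁.1) := isPermInvariant_of_mem_symmetricStates h₁
  -- Needed at the vectors d 1̂ with d in the tail C⋆-algebra, which need not be classes of elements
  -- of the free product; hence the extension by density.
  have hvec : ∀ v : ψ.GNS,
      (a : ℂ) * ⟪gnsVacuum (positiveOfState h₁.1), gnsDominated hdom₁ v⟫_ℂ +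
        b * ⟪gnsVacuum (positiveOfState h₂.1), gnsDominated hdom₂ v⟫_ℂ =
          ⟪gnsVacuum ψ, v⟫_ℂ := by
    refine mem_of_isClosed_of_gnsVec (isClosed_eq (by fun_prop) (by fun_prop)) fun M x _ => ?_
    change (a : ℂ) * ⟪gnsVacuum (positiveOfState h₁.1), gnsDominated hdom₁ (gnsVec ψ x)⟫_ℂ +
      b * ⟪gnsVacuum (positiveOfState h₂.1), gnsDominated hdom₂ (gnsVec ψ x)⟫_ℂ =
        ⟪gnsVacuum ψ, gnsVec ψ x⟫_ℂ
    rw [gnsDominated_gnsVec, gnsDominated_gnsVec, ← gnsVec_one, ← gnsVec_one, ← gnsVec_one,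
      inner_gnsVec, inner_gnsVec, inner_gnsVec, star_one, one_mul, positiveOfState_apply,
      positiveOfState_apply, heq']
  have hpure := hρ.2 (dominatedRestriction_mem_stateSpace hdom₁ hinv h₁.1.1)
    (dominatedRestriction_mem_stateSpace hdom₂ hinv h₂.1.1)
    ⟨a, b, ha, hb, hab, LinearMap.ext fun d => hvec ((d : GNSOp ψ) (gnsVacuum ψ))⟩
  refine LinearMap.ext fun x => ?_
  refine (apply_eq_dominatedRestriction hdom₁ hinv hi₁ x).trans ?_
  rw [hpure]
  exact (apply_eq_tailRestriction hinv x).symm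

/-- The linear functional `ρ ∘ F_ψ ∘ π_ψ` on the free product. -/
def inducedFunctional (hψ : IsPermInvariant ψ) (ρ : tailCStar ψ →ₗ[ℂ] ℂ) : FreeProd A →ₗ[ℂ] ℂ :=
  ρ ∘ₗ LinearMap.codRestrict (Subalgebra.toSubmodule (tailCStar ψ).toSubalgebra)
    (tailExpectationLM hψ ∘ₗ (gnsToExtension ψ).toAlgHom.toLinearMap)
    (tailExpectation_mem_tailCStar hψ)

lemma inducedFunctional_apply (hψ : IsPermInvariant ψ) (ρ : tailCStar ψ →ₗ[ℂ] ℂ)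
    (x : FreeProd A) :
    inducedFunctional hψ ρ x = ρ ⟨_, tailExpectation_mem_tailCStar hψ x⟩ := rfl

/-- A state of the tail C⋆-algebra is positive on squares from that algebra, so the positive
operator F(π(x*x)) must have its square root there; closedness provides it. Symmetry is
`tailExpectation_reindex`. -/
lemma inducedFunctional_mem_symmetricStates (hψ : IsPermInvariant ψ) {ρ : tailCStar ψ →ₗ[ℂ] ℂ}
    (hρ : ρ ∈ stateSpace (tailCStar ψ)) : inducedFunctional hψ ρ ∈ symmetricStates A := by
  refine ⟨⟨?_, fun x => ?_⟩, fun σ w => ?_⟩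
  · rw [inducedFunctional_apply, ← hρ.1]
    congr 1
    refine Subtype.ext ?_
    change tailExpectation ψ (gnsToExtension ψ 1) = 1
    rw [map_one, tailExpectation_of_mem_tailAlgebra hψ (one_mem _)]
    rfl
  · obtain ⟨R, hR, hR'⟩ := (tailCStar ψ).exists_star_mul_self (isClosed_tailCStar ψ)
      (tailExpectation_mem_tailCStar hψ (star x * x)) (by
        rw [map_mul, map_star]
        exact tailExpectation_nonneg hψ _)
    have h : (⟨_, tailExpectation_mem_tailCStar hψ (star x * x)⟩ : tailCStar ψ) = star R * R := by
      rw [hR']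
      exact Subtype.ext hR
    rw [inducedFunctional_apply, h]
    exact hρ.2 R
  · rw [← FreeProd.reindex_word, inducedFunctional_apply, inducedFunctional_apply]
    congr 1
    exact Subtype.ext (tailExpectation_reindex hψ σ (FreeProd.word w)).symm

/-- If the symmetric state is extreme and the tail C⋆-algebra is contained in the image of the free
product, then the restriction of the vector state to the tail C⋆-algebra is pure. -/
lemma isPureState_of_mem_extremePoints
    (hext : ψ.toLinearMap ∈ Set.extremePoints ℝ (symmetricStates A))
    (hD : (tailCStar ψ : Set (GNSOp ψ)) ⊆ Set.range ψ.gnsStarAlgHom) :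
    IsPureState (tailRestriction ψ) := by
  have hψ := isPermInvariant_of_mem_symmetricStates hext.1
  refine ⟨tailRestriction_mem_stateSpace hext.1.1.1, fun ρ₁ h₁ ρ₂ h₂ hseg => ?_⟩
  obtain ⟨a, b, ha, hb, hab, heq⟩ := hseg
  have h := hext.2 (inducedFunctional_mem_symmetricStates hψ h₁)
    (inducedFunctional_mem_symmetricStates hψ h₂) ⟨a, b, ha, hb, hab, LinearMap.ext fun x =>
      (LinearMap.congr_fun heq _).trans (apply_eq_tailRestriction hψ x).symm⟩
  refine LinearMap.ext fun d => ?_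
  obtain ⟨x, hx⟩ := hD d.2
  -- π(x) = d is already in the tail algebra, where the expectation is the identity.
  have hd : d = ⟨_, tailExpectation_mem_tailCStar hψ x⟩ := by
    refine Subtype.ext ?_
    have hmem : (gnsToExtension ψ x : GNSOp ψ) ∈ tailAlgebra ψ := by
      rw [coe_gnsToExtension, hx]
      exact tailCStar_le_tailAlgebra hψ d.2
    exact hx.symm.trans (tailExpectation_of_mem_tailAlgebra hψ hmem).symm
  rw [hd, ← inducedFunctional_apply, ← apply_eq_tailRestriction hψ]
  exact LinearMap.congr_fun h x

end

theorem mainTheorem11 {A : Type u} [CStarAlgebra A] (ψ : FreeProd A →ₚ[ℂ] ℂ)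
    (hψ : ψ.toLinearMap ∈ symmetricStates A) :
    -- the shift is well defined, and so is the conditional expectation onto the tail algebra
    ((∃! α : tailExtension ψ →⋆ₐ[ℂ] tailExtension ψ, IsTailShift ψ α) ∧
      ∀ x : tailExtension ψ,
        Filter.Tendsto (shiftOrbit ψ x) Filter.atTop (𝓝 (.ofCLM (tailExpectation ψ x))) ∧
        tailExpectation ψ x ∈ tailAlgebra ψ) ∧
    -- `ψ = ρ ∘ F_ψ ∘ π_ψ`
    (∃ hD : ∀ x : FreeProd A, tailExpectation ψ (gnsToExtension ψ x) ∈ tailCStar ψ,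
      ∀ x : FreeProd A, ψ x = tailRestriction ψ ⟨_, hD x⟩) ∧
    -- if `ρ` is pure, then `ψ` is extreme
    (IsPureState (tailRestriction ψ) →
      ψ.toLinearMap ∈ Set.extremePoints ℝ (symmetricStates A)) ∧
    -- if `ψ` is extreme and `D_ψ ⊆ π_ψ(𝔄)`, then `ρ` is pure
    (ψ.toLinearMap ∈ Set.extremePoints ℝ (symmetricStates A) →
      (tailCStar ψ : Set (GNSOp ψ)) ⊆ Set.range ψ.gnsStarAlgHom →
      IsPureState (tailRestriction ψ)) := by
  have hinv := isPermInvariant_of_mem_symmetricStates hψ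
  exact ⟨⟨⟨tailShift ψ, isTailShift_tailShift hinv,
      fun _ hβ => hβ.ext (isTailShift_tailShift hinv)⟩,
      fun x => ⟨tendsto_shiftOrbit hinv x, tailExpectation_mem_tailAlgebra hinv x⟩⟩,
    ⟨tailExpectation_mem_tailCStar hinv, apply_eq_tailRestriction hinv⟩,
    mem_extremePoints_of_isPureState hψ, isPureState_of_mem_extremePoints⟩
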